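/- **Theorem (an elliptic analogue of the Meijer function).** Let $\omega_1,\omega_2,\omega_3$ be nonzero complex numbers, put $$p=e^{2\pi i\omega_3/\omega_2},\quad q=e^{2\pi i\omega_1/\omega_2},\quad r=e^{2\pi i\omega_3/\omega_1},\quad \tilde q=e^{-2\pi i\omega_2/\omega_1},$$ and assume $|p|,|q|,|r|<1$ (so that the $\omega_i$ are pairwise incommensurate and $|\tilde q|<1$). For $|a|,|b|<1$ and $z\neq 0$ let $$\Gamma(z;a,b)=\prod_{j,k=0}^\infty\frac{1-z^{-1}a^{j+1}b^{k+1}}{1-za^jb^k}$$ be the elliptic gamma function. Consider the system $$\Delta(u+\omega_i)=h_i(u)\,\Delta(u),\qquad i=1,2,3,\tag{1}$$ for a meromorphic function $\Delta$ on $\mathbb C$, where $h_1,h_2,h_3$ are elliptic functions (constants allowed) with periods $(\omega_2,\omega_3)$, $(\omega_1,\omega_3)$, $(\omega_1,\omega_2)$ respectively, and the functions $$\Phi(u)=\prod_{j=0}^m\frac{\Gamma(t_je^{2\pi iu/\omega_2};p,q)}{\Gamma(w_je^{2\pi iu/\omega_2};p,q)}\ \prod_{j=0}^{m'}\frac{\Gamma(t'_je^{-2\pi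 iu/\omega_1};r,\tilde q)}{\Gamma(w'_je^{-2\pi iu/\omega_1};r,\tilde q)}\ e^{\gamma u},\tag{2}$$ where $m,m'\ge 0$ are integers, $\gamma\in\mathbb C$, and $t_j,w_j,t'_j,w'_j\in\mathbb C\setminus\{0\}$ satisfy $\prod_{j=0}^m t_j=\prod_{j=0}^m w_j$ and $\prod_{j=0}^{m'}t'_j=\prod_{j=0}^{m'}w'_j$. Equalities are equalities of meromorphic functions. 1. A function $\Delta$ is a meromorphic solution of (1) for some such elliptic $h_1,h_2,h_3$ if and only if $\Delta=c\,\Phi$ for some $c\in\mathbb C$ and some $\Phi$ of the form (2). 2. Suppose in addition that $\omega_1,\omega_2,\omega_3$ are incommensurate, that is, linearly independent over $\mathbb Z$. If, for given elliptic $h_1,h_2,h_3$ as above, the system (1) has a meromorphic solution that is not identically zero, then there is a $\Phi$ of the form (2) such that the meromorphic solutions of (1) are exactly the functions $c\,\Phi$, $c\in\mathbb C$. -/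

import Mathlib

open Filter

noncomputable section

/-- Equality of meromorphic functions on `ℂ`: the values agree outside a closed discrete set.
(A meromorphic function `ℂ → ℂ` in Mathlib has arbitrary values at its poles.) -/
def MerEq (f g : ℂ → ℂ) : Prop := f =ᶠ[codiscrete ℂ] g

/-- `f` is an elliptic function with periods `a` and `b`: meromorphic on `ℂ` and doubly periodic.
(It is used only for periods `a`, `b` that are linearly independent over `ℝ`.) -/
def IsElliptic (a b : ℂ) (f : ℂ → ℂ) : Prop :=
  Meromorphic f ∧ MerEq (fun u => f (u + a)) f ∧ MerEq (fun u => f (u + b)) f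

/-- `h₁`, `h₂`, `h₃` are elliptic with periods `(ω₂, ω₃)`, `(ω₁, ω₃)`, `(ω₁, ω₂)` respectively. -/
def EllipticCoefficients (ω₁ ω₂ ω₃ : ℂ) (h₁ h₂ h₃ : ℂ → ℂ) : Prop :=
  IsElliptic ω₂ ω₃ h₁ ∧ IsElliptic ω₁ ω₃ h₂ ∧ IsElliptic ω₁ ω₂ h₃

/-- `Δ` is a meromorphic solution of `Δ(u + ωᵢ) = hᵢ(u) Δ(u)`, `i = 1, 2, 3`. -/
def IsMeromorphicSolution (ω₁ ω₂ ω₃ : ℂ) (h₁ h₂ h₃ Δ : ℂ → ℂ) : Prop :=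
  Meromorphic Δ ∧
    MerEq (fun u => Δ (u + ω₁)) (fun u => h₁ u * Δ u) ∧
    MerEq (fun u => Δ (u + ω₂)) (fun u => h₂ u * Δ u) ∧
    MerEq (fun u => Δ (u + ω₃)) (fun u => h₃ u * Δ u)

/-- The standard elliptic gamma function
`Γ(z; p, q) = ∏_{j,k ≥ 0} (1 - z⁻¹ p^(j+1) q^(k+1)) / (1 - z p^j q^k)`, for `|p|, |q| < 1` and
`z ≠ 0`; the numerator and the denominator converge absolutely. -/
def ellipticGamma (z p q : ℂ) : ℂ :=
  (∏' n : ℕ × ℕ, (1 - z⁻¹ * p ^ (n.1 + 1) * q ^ (n.2 + 1))) /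
    (∏' n : ℕ × ℕ, (1 - z * p ^ n.1 * q ^ n.2))

/-- The parameters of the product: nonzero `t₀, …, t_m`, `w₀, …, w_m` and
`t'₀, …, t'_{m'}`, `w'₀, …, w'_{m'}`, both families balanced, and an exponent `γ`. -/
structure MeijerParams where
  m : ℕ
  m' : ℕ
  t : Fin (m + 1) → ℂ
  w : Fin (m + 1) → ℂ
  t' : Fin (m' + 1) → ℂ
  w' : Fin (m' + 1) → ℂ
  γ : ℂ
  t_ne_zero : ∀ j, t j ≠ 0
  w_ne_zero : ∀ j, w j ≠ 0
  t'_ne_zero : ∀ j, t' j ≠ 0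
  w'_ne_zero : ∀ j, w' j ≠ 0
  balanced : ∏ j, t j = ∏ j, w j
  balanced' : ∏ j, t' j = ∏ j, w' j

/-- The product
`∏ⱼ Γ(tⱼ e^{2πiu/ω₂}; p, q) / Γ(wⱼ e^{2πiu/ω₂}; p, q)`
`· ∏ⱼ Γ(t'ⱼ e^{-2πiu/ω₁}; r, q̃) / Γ(w'ⱼ e^{-2πiu/ω₁}; r, q̃) · e^{γu}`. -/
def meijerProduct (ω₁ ω₂ p q r qt : ℂ) (P : MeijerParams) (u : ℂ) : ℂ :=
  (∏ j, ellipticGamma (P.t j * Complex.exp (2 * Real.pi * Complex.I * u / ω₂)) p q /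
      ellipticGamma (P.w j * Complex.exp (2 * Real.pi * Complex.I * u / ω₂)) p q) *
  (∏ j, ellipticGamma (P.t' j * Complex.exp (-2 * Real.pi * Complex.I * u / ω₁)) r qt /
      ellipticGamma (P.w' j * Complex.exp (-2 * Real.pi * Complex.I * u / ω₁)) r qt) *
  Complex.exp (P.γ * u)

end

open scoped Topology

/-! Everything rests on two functional equations, θ(qx; q) = -x⁻¹ θ(x; q) (`mulTheta_mul`) and Γ(pz;
p, q) = θ(z; q) Γ(z; p, q) (`ellipticGamma_mul`). By the second one and the symmetry in p and q, a
balanced gamma quotient has elliptic multipliers along the two shifts that realize its bases, and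
multiplier 1 along the period of its exponential variable. Replacing ω₁, ω₃ by -ω₁, -ω₃ treats the
second family in the same way. Hence every product Φ solves a system with elliptic coefficients.

Conversely, let Δ be a nonzero solution. An elliptic function is a constant times a balanced theta
quotient (`exists_balanced_thetaProd`), so `h₁` (nome p) and `h₂` (nome r) are, up to constants, the
multipliers of gamma quotients `G₁` along ω₁ and `G₂` along ω₂. Since `G₁` is ω₂-periodic and `G₂`
is ω₁-periodic, Δ / (`G₁` `G₂`) has constant multipliers along both ω₁ and ω₂. It is therefore an
exponential times a theta quotient of nome q (`exists_theta_quotient_of_multipliers`), and that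
quotient is again a balanced gamma quotient (`thetaProd_merEq_gammaProd`).

For incommensurate periods, the quotient of a solution by a nonzero solution is invariant under a
non-discrete group of translations, hence constant (`merEq_const_of_three_periods`). -/

/-! ### Meromorphic functions up to closed discrete sets -/

theorem merEq_iff {f g : ℂ → ℂ} : MerEq f g ↔ ∀ x, f =ᶠ[𝓝[≠] x] g := by
  unfold MerEq EventuallyEq Filter.Eventually
  simp [mem_codiscrete, disjoint_principal_right]

instance codiscrete_complex_neBot : (codiscrete ℂ).NeBot := by
  refine ⟨fun h => ?_⟩
  have h0 : (∅ : Set ℂ) ∈ codiscrete ℂ := by simp [h]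
  have := mem_codiscrete.1 h0 0
  simp only [Set.compl_empty, principal_univ, disjoint_top] at this
  exact (inferInstance : (𝓝[≠] (0 : ℂ)).NeBot).ne this

theorem tendsto_add_const_codiscrete (a : ℂ) :
    Tendsto (fun u : ℂ => u + a) (codiscrete ℂ) (codiscrete ℂ) := by
  intro s hs
  rw [mem_map, mem_codiscrete]
  intro x
  have h := mem_codiscrete.1 hs (x + a)
  rw [disjoint_principal_right, compl_compl] at h ⊢
  have ht : Tendsto (fun u : ℂ => u + a) (𝓝[≠] x) (𝓝[≠] (x + a)) :=
    tendsto_nhdsWithin_of_tendsto_nhds_of_eventually_within _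
      (((continuous_add_const a).tendsto x).mono_left nhdsWithin_le_nhds)
      (by filter_upwards [self_mem_nhdsWithin] with u hu
          simpa using hu)
  exact ht h

theorem MerEq.shift {f g : ℂ → ℂ} (h : MerEq f g) (a : ℂ) :
    MerEq (fun u => f (u + a)) (fun u => g (u + a)) :=
  (tendsto_add_const_codiscrete a).eventually h

theorem MerEq.apply_eq {f g : ℂ → ℂ} (h : MerEq f g) {x : ℂ} (hf : ContinuousAt f x)
    (hg : ContinuousAt g x) : f x = g x :=
  tendsto_nhds_unique ((hf.tendsto.mono_left nhdsWithin_le_nhds).congr' (merEq_iff.1 h x))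
    (hg.tendsto.mono_left nhdsWithin_le_nhds)

theorem MerEq.eq_of_continuous {f g : ℂ → ℂ} (h : MerEq f g) (hf : Continuous f)
    (hg : Continuous g) : f = g :=
  funext fun _ => h.apply_eq hf.continuousAt hg.continuousAt

theorem Meromorphic.comp_add_const {f : ℂ → ℂ} (hf : Meromorphic f) (a : ℂ) :
    Meromorphic (fun u => f (u + a)) :=
  Meromorphic.meromorphic_fun_comp_add_const_iff_meromorphic.2 hf

/-- A nonzero element of the field of meromorphic functions. -/
structure MerUnit (f : ℂ → ℂ) : Prop where
  mer : Meromorphic f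
  ne : ∀ᶠ u in codiscrete ℂ, f u ≠ 0

/-- Identity theorem: on the connected plane, finite order at one point forces finite order
everywhere. -/
theorem Meromorphic.merUnit {f : ℂ → ℂ} (hf : Meromorphic f)
    (h : ¬ MerEq f (fun _ => 0)) : MerUnit f := by
  refine ⟨hf, ?_⟩
  have hx : ∃ x, meromorphicOrderAt f x ≠ ⊤ := by
    by_contra! hc
    exact h (merEq_iff.2 fun x => meromorphicOrderAt_eq_top_iff.1 (hc x))
  obtain ⟨x, hx⟩ := hx
  exact (hf.meromorphicOn (s := Set.univ)).eventually_codiscreteWithin_apply_ne_zero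
    fun y _ => hf.meromorphicOn.meromorphicOrderAt_ne_top_of_isPreconnected isPreconnected_univ
      (Set.mem_univ x) (Set.mem_univ y) hx

namespace MerUnit

variable {f g : ℂ → ℂ}

theorem order_ne_top (hf : MerUnit f) (x : ℂ) : meromorphicOrderAt f x ≠ ⊤ := by
  rw [meromorphicOrderAt_ne_top_iff_eventually_ne_zero (hf.mer x)]
  have := mem_codiscrete.1 hf.ne x
  rwa [disjoint_principal_right, compl_compl] at this

theorem mul (hf : MerUnit f) (hg : MerUnit g) : MerUnit (fun u => f u * g u) :=
  ⟨hf.mer.fun_mul hg.mer, by filter_upwards [hf.ne, hg.ne] with u h1 h2 using mul_ne_zero h1 h2⟩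

theorem div (hf : MerUnit f) (hg : MerUnit g) : MerUnit (fun u => f u / g u) :=
  ⟨hf.mer.fun_div hg.mer, by filter_upwards [hf.ne, hg.ne] with u h1 h2 using div_ne_zero h1 h2⟩

theorem zpow (hf : MerUnit f) (n : ℤ) : MerUnit (fun u => f u ^ n) :=
  ⟨hf.mer.fun_zpow, by filter_upwards [hf.ne] with u h1 using zpow_ne_zero n h1⟩

theorem prod {ι : Type*} (s : Finset ι) {F : ι → ℂ → ℂ} (hF : ∀ i ∈ s, MerUnit (F i)) :
    MerUnit (fun u => ∏ i ∈ s, F i u) := by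
  refine ⟨Meromorphic.fun_prod fun i hi => (hF i hi).mer, ?_⟩
  have : ∀ᶠ u in codiscrete ℂ, ∀ i ∈ s, F i u ≠ 0 :=
    (eventually_all_finset s).2 fun i hi => (hF i hi).ne
  filter_upwards [this] with u hu using Finset.prod_ne_zero_iff.2 hu

theorem shift (hf : MerUnit f) (a : ℂ) : MerUnit (fun u => f (u + a)) :=
  ⟨hf.mer.comp_add_const a, (tendsto_add_const_codiscrete a).eventually hf.ne⟩

theorem congr (hf : MerUnit f) (h : MerEq f g) : MerUnit g :=
  ⟨hf.mer.congr_codiscrete h, by filter_upwards [hf.ne, h] with u h1 h2; rwa [← h2]⟩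

theorem of_differentiable (hf : Differentiable ℂ f) (x : ℂ) (hx : f x ≠ 0) : MerUnit f := by
  refine Meromorphic.merUnit (fun y => (hf.analyticAt y).meromorphicAt) fun h => hx ?_
  exact congrFun (h.eq_of_continuous hf.continuous continuous_const) x

theorem exp (γ : ℂ) : MerUnit (fun u => Complex.exp (γ * u)) :=
  of_differentiable (by fun_prop) 0 (Complex.exp_ne_zero _)

end MerUnit

/-! ### Infinite products: theta and elliptic gamma functions -/

/-- The genus zero product `∏ᵢ (1 - x aᵢ)`. -/
noncomputable def linProd {ι : Type*} (a : ι → ℂ) (x : ℂ) : ℂ := ∏' i, (1 - x * a i)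

section linProd

variable {ι : Type*} {a : ι → ℂ}

theorem multipliable_one_sub_mul (ha : Summable fun i => ‖a i‖) (x : ℂ) :
    Multipliable fun i => 1 - x * a i := by
  simp only [sub_eq_add_neg]
  exact multipliable_one_add_of_summable (by simpa using ha.mul_left ‖x‖)

theorem linProd_ne_zero (ha : Summable fun i => ‖a i‖) {x : ℂ} (hx : ∀ i, 1 - x * a i ≠ 0) :
    linProd a x ≠ 0 := by
  unfold linProd
  simp only [sub_eq_add_neg] at hx ⊢
  exact tprod_one_add_ne_zero_of_summable hx (by simpa using ha.mul_left ‖x‖)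

theorem linProd_zero : linProd a 0 = 1 := by simp [linProd]

theorem differentiable_linProd (ha : Summable fun i => ‖a i‖) : Differentiable ℂ (linProd a) := by
  intro x
  have hK : IsOpen (Metric.ball (0 : ℂ) (‖x‖ + 1)) := Metric.isOpen_ball
  have h := Summable.hasProdLocallyUniformlyOn_one_add (f := fun i x => -(x * a i)) hK
    (ha.mul_left (‖x‖ + 1))
    (Eventually.of_forall fun i y hy => by
      have : ‖y‖ ≤ ‖x‖ + 1 := by simpa using (mem_ball_zero_iff.1 hy).le
      simpa using mul_le_mul_of_nonneg_right this (norm_nonneg (a i)))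
    (fun i => by fun_prop)
  have hd := h.differentiableOn (Eventually.of_forall fun s => by fun_prop) hK
  have hd' := hd.differentiableAt (hK.mem_nhds (by simp : x ∈ Metric.ball (0 : ℂ) (‖x‖ + 1)))
  unfold linProd
  simpa only [sub_eq_add_neg] using hd'

end linProd

/-- The `q`-shifted factorial `(x; q)_∞`. -/
noncomputable def qPoch (x q : ℂ) : ℂ := linProd (fun k : ℕ => q ^ k) x

/-- The multiplicative theta function `(x; q)_∞ (q / x; q)_∞`. -/
noncomputable def mulTheta (x q : ℂ) : ℂ := qPoch x q * qPoch (q * x⁻¹) q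

/-- The double product `∏_{j,k} (1 - x p^j q^k)`. -/
noncomputable def doublePoch (x p q : ℂ) : ℂ :=
  linProd (fun n : ℕ × ℕ => p ^ n.1 * q ^ n.2) x

theorem summable_norm_pow {q : ℂ} (hq : ‖q‖ < 1) : Summable fun k : ℕ => ‖q ^ k‖ := by
  simpa using summable_geometric_of_lt_one (norm_nonneg q) hq

theorem summable_norm_pow_mul_pow {p q : ℂ} (hp : ‖p‖ < 1) (hq : ‖q‖ < 1) :
    Summable fun n : ℕ × ℕ => ‖p ^ n.1 * q ^ n.2‖ := by
  simp only [norm_mul]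
  exact (summable_norm_pow hp).mul_of_nonneg (summable_norm_pow hq) (fun _ => norm_nonneg _)
    (fun _ => norm_nonneg _)

theorem qPoch_eq {q : ℂ} (hq : ‖q‖ < 1) (x : ℂ) : qPoch x q = (1 - x) * qPoch (q * x) q := by
  have h : (fun k : ℕ => 1 - q * x * q ^ k) = fun k => 1 - x * q ^ (k + 1) := by
    funext k; rw [pow_succ]; ring
  have hm := multipliable_one_sub_mul (summable_norm_pow hq) (q * x)
  rw [h] at hm
  have key := tprod_eq_zero_mul' (f := fun k : ℕ => 1 - x * q ^ k) hm
  rw [pow_zero, mul_one, ← h] at key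
  exact key

/-- The row j = 0 of the double product is split off; the remaining rows are the same product at `p
* x`. -/
theorem doublePoch_eq {p q : ℂ} (hp : ‖p‖ < 1) (hq : ‖q‖ < 1) (x : ℂ) :
    doublePoch x p q = qPoch x q * doublePoch (p * x) p q := by
  have hs := summable_norm_pow_mul_pow hp hq
  have fib : ∀ (y : ℂ), doublePoch y p q = ∏' j : ℕ, ∏' k : ℕ, (1 - y * (p ^ j * q ^ k)) := by
    intro y
    refine Multipliable.tprod_prod' (multipliable_one_sub_mul hs y) fun j => ?_
    have := multipliable_one_sub_mul (summable_norm_pow hq) (y * p ^ j)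
    simpa only [mul_assoc] using this
  have hm : Multipliable fun j : ℕ => ∏' k : ℕ, (1 - p * x * (p ^ j * q ^ k)) := by
    have h1 := multipliable_one_sub_mul hs (p * x)
    refine (h1.hasProd.prod_fiberwise fun j => ?_).multipliable
    have := multipliable_one_sub_mul (summable_norm_pow hq) (p * x * p ^ j)
    simpa only [mul_assoc] using this.hasProd
  have h : (fun j : ℕ => ∏' k : ℕ, (1 - p * x * (p ^ j * q ^ k)))
      = fun j => ∏' k : ℕ, (1 - x * (p ^ (j + 1) * q ^ k)) := by
    funext j; congr 1; funext k; ring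
  rw [fib, fib]
  rw [h] at hm ⊢
  rw [tprod_eq_zero_mul' hm]
  simp [qPoch, linProd]

theorem doublePoch_comm (x p q : ℂ) : doublePoch x p q = doublePoch x q p := by
  unfold doublePoch linProd
  rw [← (Equiv.prodComm ℕ ℕ).tprod_eq]
  congr 1; funext n
  simp [mul_comm]

theorem ellipticGamma_eq (z p q : ℂ) :
    ellipticGamma z p q = doublePoch (p * q * z⁻¹) p q / doublePoch z p q := by
  unfold ellipticGamma doublePoch linProd
  congr 1 <;> · congr 1; funext n; ring

theorem ellipticGamma_comm (z p q : ℂ) : ellipticGamma z p q = ellipticGamma z q p := by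
  rw [ellipticGamma_eq, ellipticGamma_eq, doublePoch_comm, doublePoch_comm z, mul_comm p q]

/-- The hypothesis on θ excludes points where the denominator of Γ(z) vanishes: there Γ(z) is 0 by
the convention for division, and the identity can fail. -/
theorem ellipticGamma_mul {z p q : ℂ} (hp : ‖p‖ < 1) (hq : ‖q‖ < 1) (hp0 : p ≠ 0)
    (hθ : mulTheta z q ≠ 0) :
    ellipticGamma (p * z) p q = mulTheta z q * ellipticGamma z p q := by
  have h1 : qPoch z q ≠ 0 := left_ne_zero_of_mul hθ
  rw [ellipticGamma_eq, ellipticGamma_eq, doublePoch_eq hp hq z, mulTheta]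
  have : p * q * (p * z)⁻¹ = q * z⁻¹ := by rw [mul_inv]; field_simp
  rw [this, doublePoch_eq hp hq (q * z⁻¹), ← mul_assoc p q z⁻¹]
  rw [div_eq_mul_inv, div_eq_mul_inv, mul_inv]
  field_simp

theorem mulTheta_mul {x q : ℂ} (hq : ‖q‖ < 1) (hq0 : q ≠ 0) (hx : x ≠ 0) :
    mulTheta (q * x) q = -x⁻¹ * mulTheta x q := by
  unfold mulTheta
  have : q * (q * x)⁻¹ = x⁻¹ := by field_simp
  rw [this, qPoch_eq hq x, qPoch_eq hq x⁻¹]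
  field_simp
  ring

/-- This lets an integral power of `x` be absorbed into a quotient of theta functions; the value of
`C` is irrelevant. -/
theorem exists_mulTheta_zpow_mul {q : ℂ} (hq : ‖q‖ < 1) (hq0 : q ≠ 0) (k : ℤ) :
    ∃ C : ℂ, C ≠ 0 ∧ ∀ x : ℂ, x ≠ 0 → mulTheta (q ^ k * x) q = C * x ^ (-k) * mulTheta x q := by
  induction k with
  | zero => exact ⟨1, one_ne_zero, by simp⟩
  | succ n ih =>
    obtain ⟨C, hC, h⟩ := ih
    refine ⟨-C * (q ^ (n : ℤ))⁻¹, by simp [hC, hq0], fun x hx => ?_⟩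
    have e : q ^ ((n : ℤ) + 1) * x = q * (q ^ (n : ℤ) * x) := by rw [zpow_add_one₀ hq0]; ring
    rw [e, mulTheta_mul hq hq0 (mul_ne_zero (zpow_ne_zero _ hq0) hx), h x hx, mul_inv, neg_add,
      zpow_add₀ hx, zpow_neg_one]
    ring
  | pred n ih =>
    obtain ⟨C, hC, h⟩ := ih
    refine ⟨-C * q ^ (-(n : ℤ) - 1), by simp [hC, zpow_ne_zero, hq0], fun x hx => ?_⟩
    have hy : q ^ (-(n : ℤ) - 1) * x ≠ 0 := mul_ne_zero (zpow_ne_zero _ hq0) hx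
    have h2 := mulTheta_mul hq hq0 hy
    have e : q * (q ^ (-(n : ℤ) - 1) * x) = q ^ (-(n : ℤ)) * x := by
      rw [zpow_sub_one₀ hq0]; field_simp
    rw [e, h x hx] at h2
    have e3 : x ^ (-(-(n : ℤ) - 1)) = x ^ (-(-(n : ℤ))) * x := by
      rw [← zpow_add_one₀ hx]; congr 1; ring
    rw [e3]
    field_simp at h2 ⊢
    linear_combination h2

theorem qPoch_ne_zero {x q : ℂ} (hq : ‖q‖ < 1) (hx : ∀ k : ℕ, x * q ^ k ≠ 1) : qPoch x q ≠ 0 :=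
  linProd_ne_zero (summable_norm_pow hq) fun k h => hx k (sub_eq_zero.1 h).symm

theorem mulTheta_ne_zero {x q : ℂ} (hq : ‖q‖ < 1) (hq0 : q ≠ 0) (hx : x ≠ 0)
    (h : ∀ k : ℤ, x ≠ q ^ k) : mulTheta x q ≠ 0 := by
  refine mul_ne_zero (qPoch_ne_zero hq fun k hk => h (-k) ?_)
    (qPoch_ne_zero hq fun k hk => h (k + 1) ?_)
  · rw [zpow_neg, zpow_natCast]
    exact eq_inv_of_mul_eq_one_left hk
  · rw [zpow_add_one₀ hq0, zpow_natCast]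
    field_simp at hk
    rw [← hk]; ring

/-! ### Lattices and quasiperiodic entire functions -/

theorem linearIndependent_pair_of_im_ne_zero {a b : ℂ} (h : (b / a).im ≠ 0) :
    LinearIndependent ℝ ![a, b] := by
  have ha : a ≠ 0 := by rintro rfl; simp at h
  rw [LinearIndependent.pair_iff]
  intro s t hst
  have h1 : (s : ℂ) + t * (b / a) = 0 := by
    simp only [Complex.real_smul] at hst
    field_simp
    linear_combination hst
  have h2 := congrArg Complex.im h1
  simp only [Complex.add_im, Complex.ofReal_im, Complex.im_ofReal_mul, zero_add,
    Complex.zero_im] at h2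
  have ht : t = 0 := (mul_eq_zero.1 h2).resolve_right h
  subst ht
  simpa using h1

theorem norm_exp_lt_one_iff (x : ℂ) :
    ‖Complex.exp (2 * Real.pi * Complex.I * x)‖ < 1 ↔ 0 < x.im := by
  rw [Complex.norm_exp, Real.exp_lt_one_iff]
  have : (2 * Real.pi * Complex.I * x).re = -(2 * Real.pi * x.im) := by simp
  rw [this, neg_lt_zero]
  exact mul_pos_iff_of_pos_left Real.two_pi_pos

/-- The codomain is arbitrary because the lemma serves both for functions and for their order of
vanishing. -/
theorem periodic_of_mem_lattice (L : PeriodPair) {X : Type*} {f : ℂ → X}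
    (h1 : ∀ u, f (u + L.ω₁) = f u) (h2 : ∀ u, f (u + L.ω₂) = f u) {w : ℂ} (hw : w ∈ L.lattice)
    (u : ℂ) : f (u + w) = f u := by
  obtain ⟨m, n, rfl⟩ := PeriodPair.mem_lattice.1 hw
  rw [← add_assoc, (Function.Periodic.int_mul (f := f) h2 n) _,
    (Function.Periodic.int_mul (f := f) h1 m) _]

/-- Liouville's theorem for entire doubly periodic functions. -/
theorem entire_elliptic_const (L : PeriodPair) {f : ℂ → ℂ} (hf : Differentiable ℂ f)
    (h1 : ∀ u, f (u + L.ω₁) = f u) (h2 : ∀ u, f (u + L.ω₂) = f u) (x y : ℂ) : f x = f y :=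
  hf.apply_eq_apply_of_bounded (IsZLattice.isCompact_range_of_periodic L.lattice _ hf.continuous
    fun z _ hw => periodic_of_mem_lattice L h1 h2 hw z).isBounded x y

theorem logDeriv_shift {F : ℂ → ℂ} (hF : Differentiable ℂ F) (hF0 : ∀ u, F u ≠ 0) {a c κ : ℂ}
    (h : ∀ u, F (u + a) = c * Complex.exp (κ * u) * F u) (u : ℂ) :
    logDeriv F (u + a) = logDeriv F u + κ := by
  have hc : c ≠ 0 := by
    rintro rfl
    exact hF0 _ ((h 0).trans (by simp))
  have hd : HasDerivAt (fun v => c * Complex.exp (κ * v) * F v)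
      (c * (Complex.exp (κ * u) * (κ * 1)) * F u + c * Complex.exp (κ * u) * deriv F u) u :=
    ((((hasDerivAt_id u).const_mul κ).cexp).const_mul c).mul (hF u).hasDerivAt
  have hd2 := ((hF (u + a)).hasDerivAt.comp_add_const u a)
  rw [funext h] at hd2
  have := hd2.unique hd
  have he := Complex.exp_ne_zero (κ * u)
  rw [logDeriv_apply, logDeriv_apply, this, h u]
  field_simp [hF0 u]
  ring

/-- An entire function without zeros which is multiplied by a constant under one period and by an
exponential under the other is itself an exponential. -/
theorem entire_quasiperiodic (L : PeriodPair) {F : ℂ → ℂ} (hF : Differentiable ℂ F)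
    (hF0 : ∀ u, F u ≠ 0) {c₁ c₂ κ : ℂ} (h1 : ∀ u, F (u + L.ω₁) = c₁ * F u)
    (h2 : ∀ u, F (u + L.ω₂) = c₂ * Complex.exp (κ * u) * F u) :
    κ = 0 ∧ ∃ C β : ℂ, C ≠ 0 ∧ ∀ u, F u = C * Complex.exp (β * u) := by
  have hω : L.ω₁ ≠ 0 := L.indep.ne_zero 0
  have e1 : ∀ u, logDeriv F (u + L.ω₁) = logDeriv F u := fun u => by
    simpa using logDeriv_shift hF hF0 (κ := 0) (c := c₁) (by simpa using h1) u
  have e2 := logDeriv_shift hF hF0 h2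
  -- `G` changes by a constant under each period, so its derivative is entire and elliptic, hence
  -- constant, and `G` is affine.
  set G := logDeriv F with hG
  have hGd : Differentiable ℂ G := by
    have : Differentiable ℂ (deriv F) := hF.contDiff.differentiable_deriv_two
    exact this.div hF hF0
  have hG' : Differentiable ℂ (deriv G) := hGd.contDiff.differentiable_deriv_two
  have hper : ∀ a κ' : ℂ, (∀ u, G (u + a) = G u + κ') → ∀ u, deriv G (u + a) = deriv G u := by
    intro a κ' h u
    rw [← deriv_comp_add_const, funext h, deriv_add_const]
  have hconst := entire_elliptic_const L hG' (hper _ 0 (by simpa using e1)) (hper _ κ e2)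
  have hlin : ∀ u, G u = G 0 + deriv G 0 * u := by
    intro u
    have hd : ∀ v, HasDerivAt (fun v => G v - deriv G 0 * v) 0 v := fun v => by
      have := (hGd v).hasDerivAt.fun_sub ((hasDerivAt_id v).const_mul (deriv G 0))
      rw [hconst v 0] at this
      exact this.congr_deriv (by ring)
    have := is_const_of_deriv_eq_zero (fun v => (hd v).differentiableAt) (fun v => (hd v).deriv) u 0
    simp only [mul_zero, sub_zero] at this
    linear_combination this
  -- The nonzero period `L.ω₁` of the affine function `G` forces slope zero; the shift by `L.ω₂`
  -- then forces `κ = 0`.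
  have hα : deriv G 0 = 0 := by
    have := e1 0
    rw [hlin (0 + L.ω₁)] at this
    simpa [hω] using this
  rw [hα] at hlin
  simp only [zero_mul, add_zero] at hlin
  refine ⟨?_, F 0, G 0, hF0 0, fun u => ?_⟩
  · have := e2 0
    rw [hlin (0 + L.ω₂)] at this
    simpa using this
  · have hd : ∀ v, HasDerivAt (fun v => F v * Complex.exp (-(G 0 * v))) 0 v := fun v => by
      have h3 := (hF v).hasDerivAt.mul ((((hasDerivAt_id v).const_mul (G 0)).neg).cexp)
      have h4 : deriv F v = G 0 * F v := by
        rw [← hlin v, hG, logDeriv_apply, div_mul_cancel₀ _ (hF0 v)]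
      rw [h4] at h3
      exact h3.congr_deriv (by ring)
    have := is_const_of_deriv_eq_zero (fun v => (hd v).differentiableAt) (fun v => (hd v).deriv) u 0
    simp only [mul_zero, neg_zero, Complex.exp_zero, mul_one] at this
    rw [← this, mul_assoc, ← Complex.exp_add]
    simp

/-! ### Functions with three incommensurate periods -/

/-- Three complex numbers that are linearly independent over `ℤ` generate a group with
arbitrarily small nonzero elements. -/
theorem not_discreteTopology_span_of_linearIndependent {v : Fin 3 → ℂ}
    (h : LinearIndependent ℤ v) : ¬ DiscreteTopology (Submodule.span ℤ (Set.range v)) := by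
  intro hd
  -- A discrete subgroup has ℤ-rank equal to the real dimension of its span, which is at most 2 in
  -- `ℂ`.
  have h1 := Real.finrank_eq_int_finrank_of_discrete hd
  have h2 : Set.finrank ℤ (Set.range v) = 3 := by
    unfold Set.finrank
    rw [finrank_span_eq_card h]; simp
  have h3 : Set.finrank ℝ (Set.range v) ≤ 2 := by
    rw [← Complex.finrank_real_complex]
    exact Submodule.finrank_le _
  omega

theorem frequently_mem_span_of_linearIndependent {v : Fin 3 → ℂ} (h : LinearIndependent ℤ v) :
    ∃ᶠ w in 𝓝[≠] (0 : ℂ), w ∈ Submodule.span ℤ (Set.range v) := by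
  intro hc
  apply not_discreteTopology_span_of_linearIndependent h
  rw [discreteTopology_iff_isOpen_singleton_zero, isOpen_induced_iff]
  rw [eventually_nhdsWithin_iff] at hc
  obtain ⟨U, hU, hUo, h0⟩ := eventually_nhds_iff.1 hc
  refine ⟨U, hUo, ?_⟩
  ext w
  simp only [Set.mem_preimage, Set.mem_singleton_iff]
  constructor
  · intro hw
    by_contra hne
    exact hU w hw (by simpa using hne) w.2
  · rintro rfl
    exact h0

theorem MerEq.span_period {f : ℂ → ℂ} {s : Set ℂ} (hs : ∀ a ∈ s, MerEq (fun u => f (u + a)) f)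
    {w : ℂ} (hw : w ∈ Submodule.span ℤ s) : MerEq (fun u => f (u + w)) f := by
  rw [← Submodule.mem_toAddSubgroup, Submodule.span_int_eq_addSubgroupClosure] at hw
  induction hw using AddSubgroup.closure_induction with
  | mem x hx => exact hs x hx
  | zero => simp only [add_zero]; exact EventuallyEq.rfl
  | add x y _ _ hx hy =>
    have := (hx.shift y).trans hy
    simp only [add_assoc, add_comm y x] at this
    exact this
  | neg x _ hx =>
    have := (hx.shift (-x)).symm
    simp only [neg_add_cancel_right] at this
    exact this

theorem merEq_const_of_three_periods {f : ℂ → ℂ} (hf : Meromorphic f) {v : Fin 3 → ℂ}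
    (h : LinearIndependent ℤ v) (hv : ∀ i, MerEq (fun u => f (u + v i)) f) :
    ∃ c : ℂ, MerEq f (fun _ => c) := by
  have hcod : ∀ᶠ x in codiscrete ℂ, AnalyticAt ℂ f x :=
    MeromorphicOn.analyticAt_mem_codiscreteWithin hf.meromorphicOn
  obtain ⟨x, hx⟩ := hcod.exists
  refine ⟨f x, ?_⟩
  -- Otherwise `x` is an isolated zero of `f - f x`, while arbitrarily small nonzero periods `w`
  -- produce zeros `x + w`.
  by_contra hne
  have hsub : Meromorphic (fun u => f u - f x) := hf.fun_sub (.const _)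
  have hunit := hsub.merUnit fun h0 => hne (by
    unfold MerEq
    filter_upwards [h0] with u hu using sub_eq_zero.1 hu)
  have hev := mem_codiscrete.1 hunit.ne x
  rw [disjoint_principal_right, compl_compl] at hev
  have ht : Tendsto (fun w : ℂ => x + w) (𝓝 0) (𝓝 x) := by
    simpa using (continuous_const_add x).tendsto 0
  have ht' : Tendsto (fun w : ℂ => x + w) (𝓝[≠] 0) (𝓝[≠] x) :=
    tendsto_nhdsWithin_of_tendsto_nhds_of_eventually_within _ (ht.mono_left nhdsWithin_le_nhds)
      (by filter_upwards [self_mem_nhdsWithin] with u hu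
          simpa using hu)
  have han := (ht.eventually hx.eventually_analyticAt).filter_mono
    (nhdsWithin_le_nhds (s := {(0 : ℂ)}ᶜ))
  obtain ⟨w, hw, hw1, hw2⟩ := ((frequently_mem_span_of_linearIndependent h).and_eventually
    (han.and (ht'.eventually hev))).exists
  apply hw2
  have hp := MerEq.span_period (f := f) (s := Set.range v) (by rintro _ ⟨i, rfl⟩; exact hv i) hw
  -- The periodicity holds only off a discrete set; continuity at `x` and at `x + w` makes it valid
  -- at the point `x`.
  have hcomp : ContinuousAt (fun u => f (u + w)) x :=
    ContinuousAt.comp (g := f) (f := fun u => u + w) hw1.continuousAt (by fun_prop)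
  exact sub_eq_zero.2 (hp.apply_eq hcomp hx.continuousAt)

/-! ### Theta functions in the additive variable -/

/-- The exponential `e^{2πiu/Ω}`. -/
noncomputable def eexp (Ω u : ℂ) : ℂ := Complex.exp (2 * Real.pi * Complex.I * u / Ω)

section eexp

variable {Ω : ℂ}

theorem eexp_ne_zero (Ω u : ℂ) : eexp Ω u ≠ 0 := Complex.exp_ne_zero _

theorem eexp_add (Ω u v : ℂ) : eexp Ω (u + v) = eexp Ω u * eexp Ω v := by
  rw [eexp, eexp, eexp, ← Complex.exp_add]; congr 1; ring

theorem eexp_neg (Ω u : ℂ) : eexp Ω (-u) = (eexp Ω u)⁻¹ := by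
  rw [eexp, eexp, ← Complex.exp_neg]; congr 1; ring

theorem eexp_neg_left (Ω u : ℂ) : eexp (-Ω) u = (eexp Ω u)⁻¹ := by
  rw [eexp, eexp, ← Complex.exp_neg, div_neg]

theorem eexp_self (hΩ : Ω ≠ 0) : eexp Ω Ω = 1 := by
  rw [eexp, mul_div_cancel_right₀ _ hΩ, Complex.exp_two_pi_mul_I]

theorem eexp_zpow (Ω u : ℂ) (n : ℤ) :
    eexp Ω u ^ n = Complex.exp (n * (2 * Real.pi * Complex.I / Ω) * u) := by
  rw [eexp, ← Complex.exp_int_mul]; congr 1; ring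

theorem exists_eexp_eq (hΩ : Ω ≠ 0) {t : ℂ} (ht : t ≠ 0) : ∃ u, eexp Ω u = t := by
  refine ⟨Complex.log t * Ω / (2 * Real.pi * Complex.I), ?_⟩
  rw [eexp]
  have : 2 * Real.pi * Complex.I * (Complex.log t * Ω / (2 * Real.pi * Complex.I)) / Ω
      = Complex.log t := by
    have := Complex.two_pi_I_ne_zero
    field_simp
  rw [this, Complex.exp_log ht]

theorem norm_eexp_lt_one_iff (Ω u : ℂ) : ‖eexp Ω u‖ < 1 ↔ 0 < (u / Ω).im := by
  rw [eexp, mul_div_assoc, norm_exp_lt_one_iff]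

theorem differentiable_eexp (Ω : ℂ) : Differentiable ℂ (eexp Ω) := by
  unfold eexp; fun_prop

theorem exists_int_of_eexp_eq_zpow (hΩ : Ω ≠ 0) {u σ : ℂ} {k : ℤ}
    (h : eexp Ω u = eexp Ω σ ^ k) : ∃ m : ℤ, u = m * Ω + k * σ := by
  rw [eexp_zpow, eexp, Complex.exp_eq_exp_iff_exists_int] at h
  obtain ⟨m, hm⟩ := h
  refine ⟨m, ?_⟩
  have h2 := Complex.two_pi_I_ne_zero
  have h3 : 2 * Real.pi * Complex.I * (u - (m * Ω + k * σ)) = 0 := by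
    field_simp at hm
    linear_combination 2 * Real.pi * Complex.I * hm
  exact sub_eq_zero.1 ((mul_eq_zero.1 h3).resolve_left h2)

end eexp

/-- The product equals 1 at the origin, so it is nonzero at some nearby nonzero point, and every
nonzero point is a value of `t * eexp Ω u`. -/
theorem merUnit_linProd_eexp {ι : Type*} {a : ι → ℂ} (ha : Summable fun i => ‖a i‖) {Ω t : ℂ}
    (hΩ : Ω ≠ 0) (ht : t ≠ 0) : MerUnit (fun u => linProd a (t * eexp Ω u)) := by
  have hd := differentiable_linProd ha
  have hev : ∀ᶠ x in 𝓝[≠] (0 : ℂ), linProd a x ≠ 0 ∧ x ≠ 0 :=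
    ((hd.continuous.continuousAt.eventually_ne (by rw [linProd_zero]; exact one_ne_zero)).filter_mono
      nhdsWithin_le_nhds).and (self_mem_nhdsWithin)
  obtain ⟨x, hx, hx0⟩ := hev.exists
  obtain ⟨u, hu⟩ := exists_eexp_eq hΩ (div_ne_zero hx0 ht)
  refine MerUnit.of_differentiable (hd.comp ((differentiable_eexp Ω).const_mul t)) u ?_
  rwa [hu, mul_div_cancel₀ _ ht]

theorem mulTheta_eexp_eq (Ω t q u : ℂ) : mulTheta (t * eexp Ω u) q =
    linProd (fun k : ℕ => q ^ k) (t * eexp Ω u) *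
      linProd (fun k : ℕ => q ^ k) (q * t⁻¹ * eexp (-Ω) u) := by
  rw [mulTheta, qPoch, qPoch, eexp_neg_left, mul_inv, mul_assoc q]

theorem differentiable_mulTheta_eexp {q : ℂ} (hq : ‖q‖ < 1) (Ω t : ℂ) :
    Differentiable ℂ (fun u => mulTheta (t * eexp Ω u) q) := by
  have hd := differentiable_linProd (summable_norm_pow hq)
  simp only [mulTheta_eexp_eq]
  exact (hd.comp ((differentiable_eexp Ω).const_mul _)).mul
    (hd.comp ((differentiable_eexp (-Ω)).const_mul _))

theorem merUnit_mulTheta_eexp {q : ℂ} (hq : ‖q‖ < 1) (hq0 : q ≠ 0) {Ω t : ℂ} (hΩ : Ω ≠ 0)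
    (ht : t ≠ 0) : MerUnit (fun u => mulTheta (t * eexp Ω u) q) := by
  simp only [mulTheta_eexp_eq]
  exact (merUnit_linProd_eexp (summable_norm_pow hq) hΩ ht).mul
    (merUnit_linProd_eexp (summable_norm_pow hq) (neg_ne_zero.2 hΩ)
      (mul_ne_zero hq0 (inv_ne_zero ht)))

/-- The factor `1 - x` has a simple zero at `x = 1`, and the cofactor there is (q; q)_∞², which is
nonzero. -/
theorem meromorphicOrderAt_mulTheta_self {q : ℂ} (hq : ‖q‖ < 1) {Ω : ℂ} (hΩ : Ω ≠ 0) (s : ℂ) :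
    meromorphicOrderAt (fun u => mulTheta (eexp Ω (-s) * eexp Ω u) q) s = 1 := by
  have hd := differentiable_linProd (summable_norm_pow hq)
  have e0 : eexp Ω (-s) * eexp Ω s = 1 := by
    rw [eexp_neg, inv_mul_cancel₀ (eexp_ne_zero _ _)]
  set f : ℂ → ℂ := fun u => 1 - eexp Ω (-s) * eexp Ω u with hf
  set g : ℂ → ℂ := fun u => linProd (fun k : ℕ => q ^ k) (q * (eexp Ω (-s) * eexp Ω u)) *
    linProd (fun k : ℕ => q ^ k) (q * (eexp Ω (-s))⁻¹ * eexp (-Ω) u) with hg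
  have hfg : (fun u => mulTheta (eexp Ω (-s) * eexp Ω u) q) = g * f := by
    funext u
    simp only [Pi.mul_apply, mulTheta_eexp_eq, hf, hg]
    have := qPoch_eq hq (eexp Ω (-s) * eexp Ω u)
    simp only [qPoch] at this
    rw [this]; ring
  have hgd : Differentiable ℂ g :=
    (hd.comp (((differentiable_eexp Ω).const_mul _).const_mul _)).mul
      (hd.comp ((differentiable_eexp (-Ω)).const_mul _))
  have hq1 : linProd (fun k : ℕ => q ^ k) q ≠ 0 := by
    refine qPoch_ne_zero hq fun k hk => ?_
    rw [← pow_succ'] at hk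
    have := congrArg norm hk
    rw [norm_pow, norm_one] at this
    exact (pow_lt_one₀ (norm_nonneg q) hq k.succ_ne_zero).ne this
  have hgs : g s ≠ 0 := by
    simp only [hg, eexp_neg_left]
    rw [e0, mul_one, mul_assoc, ← mul_inv, e0, inv_one, mul_one]
    exact mul_ne_zero hq1 hq1
  rw [hfg, meromorphicOrderAt_mul_of_ne_zero (hgd.analyticAt s) hgs]
  have hfd : HasDerivAt f (-(2 * Real.pi * Complex.I / Ω)) s := by
    have h1 : HasDerivAt (eexp Ω) (eexp Ω s * (2 * Real.pi * Complex.I / Ω)) s := by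
      have := (((hasDerivAt_id s).const_mul (2 * Real.pi * Complex.I)).div_const Ω).cexp
      exact this.congr_deriv (by simp [eexp])
    exact ((h1.const_mul (eexp Ω (-s))).const_sub 1).congr_deriv (by rw [← mul_assoc, e0, one_mul])
  have hfa : AnalyticAt ℂ f s :=
    (((differentiable_eexp Ω).const_mul _).const_sub 1).analyticAt s
  have hne : deriv f s ≠ 0 := by
    rw [hfd.deriv]
    exact neg_ne_zero.2 (div_ne_zero Complex.two_pi_I_ne_zero hΩ)
  have := hfa.analyticOrderAt_sub_eq_one_of_deriv_ne_zero hne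
  have hfs : f s = 0 := by simp [hf, e0]
  rw [hfs] at this
  simp only [sub_zero] at this
  rw [hfa.meromorphicOrderAt_eq, this]
  rfl

/-! ### Divisors and factorization into theta functions -/

/-- Points are repeated according to the positive and the negative part of `d`; total degree zero
makes both lists equally long. The lists do not depend on `φ`, so they serve for all `u` at once. -/
theorem Finset.exists_prod_zpow_eq_prod_div {α : Type*} (S : Finset α) (d : α → ℤ)
    (h : ∑ s ∈ S, d s = 0) : ∃ (n : ℕ) (a b : Fin n → α), ∀ φ : α → ℂ,
      ∏ s ∈ S, φ s ^ d s = ∏ i, φ (a i) / φ (b i) := by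
  have key : ∀ m : α → ℕ, ∃ a : Fin (∑ s ∈ S, m s) → α, ∀ φ : α → ℂ,
      ∏ i, φ (a i) = ∏ s ∈ S, φ s ^ m s := by
    intro m
    set A : Multiset α := ∑ s ∈ S, Multiset.replicate (m s) s with hA
    have hc : A.toList.length = ∑ s ∈ S, m s := by simp [hA]
    refine ⟨fun i => A.toList.get (i.cast hc.symm), fun φ => ?_⟩
    rw [Fintype.prod_equiv (finCongr hc.symm) (fun i => φ (A.toList.get (i.cast hc.symm)))
      (fun i => φ (A.toList.get i)) (fun i => rfl), ← List.prod_ofFn]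
    have : List.ofFn (fun i => φ (A.toList.get i)) = A.toList.map φ := by
      apply List.ext_get <;> simp
    rw [this, ← Multiset.prod_coe, ← Multiset.map_coe, Multiset.coe_toList, hA,
      ← Multiset.coe_mapAddMonoidHom, map_sum, Multiset.prod_sum]
    simp
  obtain ⟨a, ha⟩ := key fun s => (d s).toNat
  obtain ⟨b, hb⟩ := key fun s => (-d s).toNat
  have hcard : ∑ s ∈ S, (d s).toNat = ∑ s ∈ S, (-d s).toNat := by
    have : ∑ s ∈ S, (((d s).toNat : ℤ) - ((-d s).toNat : ℤ)) = 0 := by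
      rw [← h]; exact Finset.sum_congr rfl fun s _ => by omega
    rw [Finset.sum_sub_distrib, sub_eq_zero] at this
    exact_mod_cast this
  refine ⟨_, a, fun i => b (i.cast hcard), fun φ => ?_⟩
  rw [Finset.prod_div_distrib, ha,
    Fintype.prod_equiv (finCongr hcard) (fun i => φ (b (i.cast hcard))) (fun i => φ (b i))
      (fun i => rfl), hb, ← Finset.prod_div_distrib]
  refine Finset.prod_congr rfl fun s _ => ?_
  obtain ⟨n, hn | hn⟩ := Int.eq_nat_or_neg (d s)
  · simp [hn]
  · simp [hn]

theorem MerEq.order_shift {F g : ℂ → ℂ} {a : ℂ} (hg : Differentiable ℂ g) (hg0 : ∀ u, g u ≠ 0)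
    (h : MerEq (fun u => F (u + a)) (fun u => g u * F u)) (x : ℂ) :
    meromorphicOrderAt F (x + a) = meromorphicOrderAt F x := by
  have h1 := meromorphicOrderAt_congr (merEq_iff.1 h x)
  have h2 : meromorphicOrderAt (fun u => F (u + a)) x = meromorphicOrderAt F (x + a) :=
    meromorphicOrderAt_comp_add_const_eq_meromorphicOrderAt
  have h3 : meromorphicOrderAt (fun u => g u * F u) x = meromorphicOrderAt F x :=
    meromorphicOrderAt_mul_of_ne_zero (hg.analyticAt x) (hg0 x)
  rw [← h2, h1, h3]

/-- A meromorphic function of order zero everywhere agrees with an entire function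
without zeros. -/
theorem exists_entire_of_order_eq_zero {F : ℂ → ℂ} (hF : Meromorphic F)
    (h : ∀ x, meromorphicOrderAt F x = 0) :
    ∃ G : ℂ → ℂ, Differentiable ℂ G ∧ (∀ u, G u ≠ 0) ∧ MerEq F G := by
  have hNF : ∀ x, MeromorphicNFAt (toMeromorphicNFOn F Set.univ) x := fun x =>
    meromorphicNFOn_toMeromorphicNFOn F Set.univ (Set.mem_univ x)
  have ho : ∀ x, meromorphicOrderAt (toMeromorphicNFOn F Set.univ) x = 0 := fun x => by
    rw [meromorphicOrderAt_toMeromorphicNFOn hF.meromorphicOn (Set.mem_univ x), h x]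
  refine ⟨toMeromorphicNFOn F Set.univ, fun x => ?_, fun x => ?_,
    toMeromorphicNFOn_eqOn_codiscrete hF.meromorphicOn⟩
  · exact ((hNF x).meromorphicOrderAt_nonneg_iff_analyticAt.1 (ho x).ge).differentiableAt
  · exact (hNF x).meromorphicOrderAt_eq_zero_iff.1 (ho x)

theorem zpow_sum_eq_prod_zpow {α : Type*} {x : ℂ} (hx : x ≠ 0) (S : Finset α) (d : α → ℤ) :
    x ^ ∑ s ∈ S, d s = ∏ s ∈ S, x ^ d s := by
  classical
  induction S using Finset.induction_on with
  | empty => simp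
  | insert s S hs ih => rw [Finset.sum_insert hs, Finset.prod_insert hs, zpow_add₀ hx, ih]

/-- The divisor of a nonzero meromorphic function has finite support in a bounded set. -/
theorem MerUnit.finite_order_ne_zero {f : ℂ → ℂ} (hf : MerUnit f) {D : Set ℂ}
    (hD : Bornology.IsBounded D) : {x ∈ D | (meromorphicOrderAt f x).untop₀ ≠ 0}.Finite := by
  have hK : IsCompact (closure D) := hD.isCompact_closure
  refine ((MeromorphicOn.divisor f (closure D)).finiteSupport hK).subset ?_
  rintro x ⟨hx, hx0⟩
  rw [Function.mem_support, MeromorphicOn.divisor_apply hf.mer.meromorphicOn (subset_closure hx)]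
  exact hx0

/-- A nonzero meromorphic function with constant multipliers under two independent periods is an
exponential times a quotient of theta functions. -/
theorem exists_theta_quotient_of_multipliers {Ω σ : ℂ} (hσ : 0 < (σ / Ω).im) {f : ℂ → ℂ}
    (hf : MerUnit f) {c₁ c₂ : ℂ} (h1 : MerEq (fun u => f (u + Ω)) (fun u => c₁ * f u))
    (h2 : MerEq (fun u => f (u + σ)) (fun u => c₂ * f u)) :
    ∃ (n : ℕ) (a b : Fin n → ℂ) (C β : ℂ), (∀ k, a k ≠ 0) ∧ (∀ k, b k ≠ 0) ∧ C ≠ 0 ∧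
      MerEq f (fun u => C * Complex.exp (β * u) *
        ∏ k, mulTheta (a k * eexp Ω u) (eexp Ω σ) / mulTheta (b k * eexp Ω u) (eexp Ω σ)) := by
  have hΩ : Ω ≠ 0 := by rintro rfl; simp at hσ
  set q := eexp Ω σ with hqdef
  have hq : ‖q‖ < 1 := (norm_eexp_lt_one_iff Ω σ).2 hσ
  have hq0 : q ≠ 0 := eexp_ne_zero _ _
  have hnz : ∀ {c a : ℂ}, MerEq (fun u => f (u + a)) (fun u => c * f u) → c ≠ 0 := by
    rintro c a h rfl
    obtain ⟨u, hu1, hu2⟩ := ((hf.shift a).ne.and h).exists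
    exact hu1 (hu2.trans (zero_mul _))
  let L : PeriodPair := ⟨Ω, σ, linearIndependent_pair_of_im_ne_zero hσ.ne'⟩
  set D := ZSpan.fundamentalDomain L.basis with hD
  set d : ℂ → ℤ := fun x => (meromorphicOrderAt f x).untop₀ with hd
  have hfin : {x ∈ D | d x ≠ 0}.Finite :=
    hf.finite_order_ne_zero (ZSpan.fundamentalDomain_isBounded L.basis)
  set S := hfin.toFinset with hS
  set ϑ : ℂ → ℂ → ℂ := fun s u => mulTheta (eexp Ω (-s) * eexp Ω u) q with hϑ
  have hϑu : ∀ s, MerUnit (ϑ s) := fun s => merUnit_mulTheta_eexp hq hq0 hΩ (eexp_ne_zero _ _)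
  set Θ : ℂ → ℂ := fun u => ∏ s ∈ S, ϑ s u ^ d s with hΘ
  have hΘu : MerUnit Θ := MerUnit.prod S fun s _ => (hϑu s).zpow (d s)
  -- In `D` each `ϑ s` vanishes only at `s`, to first order, since two points of `D` congruent
  -- modulo the lattice coincide. Hence `Θ` has the divisor of `f` in `D`.
  have hord : ∀ v ∈ D, meromorphicOrderAt Θ v = d v := by
    intro v hv
    have hterm : ∀ s ∈ S, meromorphicOrderAt (fun u => ϑ s u ^ d s) v
        = if s = v then (d v : WithTop ℤ) else 0 := by
      intro s hs
      have hsD : s ∈ D := ((Set.Finite.mem_toFinset hfin).1 hs).1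
      rw [fun_meromorphicOrderAt_zpow ((hϑu s).mer v)]
      split_ifs with hsv
      · subst hsv
        rw [meromorphicOrderAt_mulTheta_self hq hΩ, mul_one]
      · have hne : ϑ s v ≠ 0 := by
          refine mulTheta_ne_zero hq hq0 (mul_ne_zero (eexp_ne_zero _ _) (eexp_ne_zero _ _))
            fun k hk => hsv ?_
          rw [← eexp_add] at hk
          obtain ⟨m, hm⟩ := exists_int_of_eexp_eq_zpow hΩ hk
          have hmem : -s + v ∈ Submodule.span ℤ (Set.range L.basis) := by
            rw [← L.lattice_eq_span_range_basis, PeriodPair.mem_lattice]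
            exact ⟨m, k, hm.symm⟩
          rw [← ZSpan.fract_eq_fract, ZSpan.fract_eq_self.2 hsD, ZSpan.fract_eq_self.2 hv] at hmem
          exact hmem
        have han := (differentiable_mulTheta_eexp hq Ω (eexp Ω (-s))).analyticAt v
        have : meromorphicOrderAt (ϑ s) v = 0 := by
          rw [han.meromorphicOrderAt_eq, han.analyticOrderAt_eq_zero.2 hne]; rfl
        rw [this, mul_zero]
    rw [hΘ, meromorphicOrderAt_fun_prod fun s _ => ((hϑu s).zpow (d s)).mer v,
      Finset.sum_congr rfl hterm, Finset.sum_ite_eq']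
    split_ifs with hvS
    · rfl
    · have : d v = 0 := by
        by_contra hne
        exact hvS ((Set.Finite.mem_toFinset hfin).2 ⟨hv, hne⟩)
      rw [this]; rfl
  set N := ∑ s ∈ S, d s with hN
  set K := ∏ s ∈ S, (-(eexp Ω (-s))⁻¹) ^ d s with hK
  have hK0 : K ≠ 0 := Finset.prod_ne_zero_iff.2 fun s _ =>
    zpow_ne_zero _ (neg_ne_zero.2 (inv_ne_zero (eexp_ne_zero _ _)))
  have hΘ1 : ∀ u, Θ (u + Ω) = Θ u := fun u => by
    simp only [hΘ, hϑ, eexp_add, eexp_self hΩ, mul_one]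
  have hΘ2 : ∀ u, Θ (u + σ) = K * eexp Ω u ^ (-N) * Θ u := fun u => by
    have hprod : eexp Ω u ^ (-N) = ∏ s ∈ S, ((eexp Ω u)⁻¹) ^ d s := by
      rw [zpow_neg, ← inv_zpow, hN]
      exact zpow_sum_eq_prod_zpow (inv_ne_zero (eexp_ne_zero Ω u)) S d
    rw [hprod, hK, hΘ, ← Finset.prod_mul_distrib, ← Finset.prod_mul_distrib]
    refine Finset.prod_congr rfl fun s _ => ?_
    have : eexp Ω (-s) * eexp Ω (u + σ) = q * (eexp Ω (-s) * eexp Ω u) := by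
      rw [eexp_add]; ring
    simp only [hϑ]
    rw [this, mulTheta_mul hq hq0 (mul_ne_zero (eexp_ne_zero _ _) (eexp_ne_zero _ _)), mul_inv,
      ← mul_zpow, ← mul_zpow]
    congr 1; ring
  set F : ℂ → ℂ := fun u => f u / Θ u with hF
  have hFu : MerUnit F := hf.div hΘu
  set κ : ℂ := N * (2 * Real.pi * Complex.I / Ω) with hκ
  have hF1 : MerEq (fun u => F (u + Ω)) (fun u => c₁ * F u) := by
    unfold MerEq
    filter_upwards [h1] with u hu
    simp only [hF]
    rw [hu, hΘ1, mul_div_assoc]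
  have hF2 : MerEq (fun u => F (u + σ)) (fun u => c₂ * K⁻¹ * Complex.exp (κ * u) * F u) := by
    unfold MerEq
    filter_upwards [h2] with u hu
    simp only [hF]
    rw [hu, hΘ2, ← eexp_zpow, zpow_neg]
    rw [div_eq_mul_inv, div_eq_mul_inv, mul_inv, mul_inv, inv_inv]
    ring
  have hFD : ∀ v ∈ D, meromorphicOrderAt F v = 0 := by
    intro v hv
    have hdv : meromorphicOrderAt f v = d v := (WithTop.coe_untop₀_of_ne_top (hf.order_ne_top v)).symm
    rw [hF, fun_meromorphicOrderAt_div (hf.mer v) (hΘu.mer v), hord v hv, hdv]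
    norm_cast
    simp
  -- The multipliers of `F` are entire without zeros, so its order is doubly periodic and the
  -- vanishing on `D` spreads to the plane.
  have hF0 : ∀ v, meromorphicOrderAt F v = 0 := by
    intro v
    have hp := periodic_of_mem_lattice L (f := meromorphicOrderAt F)
      (hF1.order_shift (g := fun _ => c₁) (by fun_prop) (fun _ => hnz h1))
      (hF2.order_shift (g := fun u => c₂ * K⁻¹ * Complex.exp (κ * u)) (by fun_prop)
        (fun u => mul_ne_zero (mul_ne_zero (hnz h2) (inv_ne_zero hK0)) (Complex.exp_ne_zero _)))
      (w := ZSpan.floor L.basis v) (by rw [L.lattice_eq_span_range_basis]; exact Subtype.coe_prop _)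
      (ZSpan.fract L.basis v)
    rw [ZSpan.fract_apply, sub_add_cancel] at hp
    rw [hp, ← ZSpan.fract_apply]
    exact hFD _ (ZSpan.fract_mem_fundamentalDomain L.basis v)
  obtain ⟨G, hGd, hG0, hFG⟩ := exists_entire_of_order_eq_zero hFu.mer hF0
  have hG1 : MerEq (fun u => G (u + Ω)) (fun u => c₁ * G u) := by
    have hs := hFG.shift Ω
    unfold MerEq
    filter_upwards [hF1, hFG, hs] with u hu1 hu2 hu3
    rw [← hu3, hu1, hu2]
  have hG2 : MerEq (fun u => G (u + σ)) (fun u => c₂ * K⁻¹ * Complex.exp (κ * u) * G u) := by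
    have hs := hFG.shift σ
    unfold MerEq
    filter_upwards [hF2, hFG, hs] with u hu1 hu2 hu3
    rw [← hu3, hu1, hu2]
  have hGc := hGd.continuous
  obtain ⟨hκ0, C, β, hC, hGe⟩ := entire_quasiperiodic L hGd hG0
    (congrFun (hG1.eq_of_continuous (by fun_prop) (by fun_prop)))
    (congrFun (hG2.eq_of_continuous (by fun_prop) (by fun_prop)))
  -- `κ` is a nonzero multiple of the degree `N`, so `κ = 0` says that zeros and poles balance.
  have hN0 : N = 0 := by
    rw [hκ] at hκ0
    have := (mul_eq_zero.1 hκ0).resolve_right (div_ne_zero Complex.two_pi_I_ne_zero hΩ)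
    exact_mod_cast this
  obtain ⟨n, a, b, hab⟩ := Finset.exists_prod_zpow_eq_prod_div S d hN0
  refine ⟨n, fun k => eexp Ω (-a k), fun k => eexp Ω (-b k), C, β, fun k => eexp_ne_zero _ _,
    fun k => eexp_ne_zero _ _, hC, ?_⟩
  unfold MerEq
  filter_upwards [hFG, hΘu.ne] with u hu hΘ0
  have e : Θ u = ∏ k, ϑ (a k) u / ϑ (b k) u := hab fun s => ϑ s u
  change f u = C * Complex.exp (β * u) * ∏ k, ϑ (a k) u / ϑ (b k) u
  rw [← e, ← hGe, ← hu]
  exact (div_mul_cancel₀ _ hΘ0).symm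

/-! ### Theta quotients and elliptic functions -/

/-- The quotient `∏ⱼ θ(tⱼ e^{2πiu/Ω}; q) / θ(wⱼ e^{2πiu/Ω}; q)`. -/
noncomputable def thetaProd {ι : Type*} [Fintype ι] (Ω q : ℂ) (t w : ι → ℂ) (u : ℂ) : ℂ :=
  ∏ j, mulTheta (t j * eexp Ω u) q / mulTheta (w j * eexp Ω u) q

section thetaProd

variable {ι : Type*} [Fintype ι] {Ω q : ℂ} {t w : ι → ℂ}

theorem merUnit_thetaProd (hq : ‖q‖ < 1) (hq0 : q ≠ 0) (hΩ : Ω ≠ 0) (ht : ∀ j, t j ≠ 0)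
    (hw : ∀ j, w j ≠ 0) : MerUnit (thetaProd Ω q t w) :=
  MerUnit.prod _ fun j _ => (merUnit_mulTheta_eexp hq hq0 hΩ (ht j)).div
    (merUnit_mulTheta_eexp hq hq0 hΩ (hw j))

theorem thetaProd_add_self (hΩ : Ω ≠ 0) (u : ℂ) :
    thetaProd Ω q t w (u + Ω) = thetaProd Ω q t w u := by
  simp only [thetaProd, eexp_add, eexp_self hΩ, mul_one]

theorem thetaProd_add (hq : ‖q‖ < 1) {σ : ℂ} (hσ : eexp Ω σ = q) (ht : ∀ j, t j ≠ 0)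
    (hw : ∀ j, w j ≠ 0) (u : ℂ) :
    thetaProd Ω q t w (u + σ) = (∏ j, w j) / (∏ j, t j) * thetaProd Ω q t w u := by
  have hq0 : q ≠ 0 := hσ ▸ eexp_ne_zero _ _
  simp only [thetaProd]
  rw [← Finset.prod_div_distrib, ← Finset.prod_mul_distrib]
  refine Finset.prod_congr rfl fun j _ => ?_
  have hu := eexp_ne_zero Ω u
  have e : ∀ x : ℂ, x * eexp Ω (u + σ) = q * (x * eexp Ω u) := fun x => by
    rw [eexp_add, hσ]; ring
  rw [e, e, mulTheta_mul hq hq0 (mul_ne_zero (ht j) hu), mulTheta_mul hq hq0 (mul_ne_zero (hw j) hu),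
    mul_div_mul_comm]
  congr 1
  have := ht j
  have := hw j
  field_simp

theorem thetaProd_cons {n : ℕ} (Ω q x y : ℂ) (a b : Fin n → ℂ) (u : ℂ) :
    thetaProd Ω q (Fin.cons x a : Fin (n + 1) → ℂ) (Fin.cons y b : Fin (n + 1) → ℂ) u =
      mulTheta (x * eexp Ω u) q / mulTheta (y * eexp Ω u) q * thetaProd Ω q a b u := by
  simp only [thetaProd, Fin.prod_univ_succ, Fin.cons_zero, Fin.cons_succ]

end thetaProd

/-- A nonzero elliptic function is a constant times a balanced quotient of theta functions. -/
theorem exists_balanced_thetaProd {Ω σ : ℂ} (hσ : 0 < (σ / Ω).im) {f : ℂ → ℂ}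
    (hf : MerUnit f) (h1 : MerEq (fun u => f (u + Ω)) f) (h2 : MerEq (fun u => f (u + σ)) f) :
    ∃ (n : ℕ) (t w : Fin (n + 1) → ℂ) (C : ℂ), (∀ k, t k ≠ 0) ∧ (∀ k, w k ≠ 0) ∧ C ≠ 0 ∧
      ∏ k, t k = ∏ k, w k ∧ MerEq f (fun u => C * thetaProd Ω (eexp Ω σ) t w u) := by
  have hΩ : Ω ≠ 0 := by rintro rfl; simp at hσ
  have hq : ‖eexp Ω σ‖ < 1 := (norm_eexp_lt_one_iff Ω σ).2 hσ
  have hq0 : eexp Ω σ ≠ 0 := eexp_ne_zero _ _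
  obtain ⟨n, a, b, C, β, ha, hb, hC, hfe⟩ := exists_theta_quotient_of_multipliers hσ hf
    (c₁ := 1) (c₂ := 1) (by simpa using h1) (by simpa using h2)
  change MerEq f (fun u => C * Complex.exp (β * u) * thetaProd Ω (eexp Ω σ) a b u) at hfe
  -- Invariance under `Ω` turns the exponential into an integral power `eexp Ω u ^ k`; invariance
  -- under `σ` then relates the two parameter products by the factor `eexp Ω σ ^ k`.
  have hexp : Complex.exp (β * Ω) = 1 := by
    obtain ⟨u, hu1, hu2, hu3, hu4⟩ :=
      (h1.and (hfe.and ((hfe.shift Ω).and hf.ne))).exists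
    refine mul_right_cancel₀ hu4 ?_
    simp only at hu1 hu2 hu3
    rw [one_mul]
    conv_rhs => rw [← hu1, hu3, thetaProd_add_self hΩ, mul_add, Complex.exp_add]
    rw [hu2]; ring
  obtain ⟨k, hk⟩ := Complex.exp_eq_one_iff.1 hexp
  have hβ : β = k * (2 * Real.pi * Complex.I / Ω) := by
    field_simp
    linear_combination hk
  have hz : ∀ u, Complex.exp (β * u) = eexp Ω u ^ k := fun u => by rw [hβ, eexp_zpow]
  have hbal : eexp Ω σ ^ k * ∏ j, b j = ∏ j, a j := by
    obtain ⟨u, hu1, hu2, hu3, hu4⟩ :=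
      (h2.and (hfe.and ((hfe.shift σ).and hf.ne))).exists
    have : eexp Ω σ ^ k * ((∏ j, b j) / ∏ j, a j) = 1 := by
      refine mul_right_cancel₀ hu4 ?_
      simp only at hu1 hu2 hu3
      rw [one_mul]
      conv_rhs => rw [← hu1, hu3, thetaProd_add hq rfl ha hb, mul_add, Complex.exp_add, hz σ]
      rw [hu2]; ring
    have ha0 : ∏ j, a j ≠ 0 := Finset.prod_ne_zero_iff.2 fun j _ => ha j
    field_simp at this
    exact this
  obtain ⟨C', hC', hθ⟩ := exists_mulTheta_zpow_mul hq hq0 (-k)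
  -- The extra factor θ(q⁻ᵏz)/θ(z) equals `C'` zᵏ: it absorbs the power of z = `eexp Ω u` and at the
  -- same time balances the parameters.
  refine ⟨n, Fin.cons (eexp Ω σ ^ (-k)) a, Fin.cons 1 b, C / C', ?_, ?_, div_ne_zero hC hC', ?_, ?_⟩
  · exact Fin.cases (zpow_ne_zero _ hq0) ha
  · exact Fin.cases one_ne_zero hb
  · rw [Fin.prod_cons, Fin.prod_cons, ← hbal, one_mul, ← mul_assoc, ← zpow_add₀ hq0]
    simp
  · have hunit := merUnit_mulTheta_eexp hq hq0 hΩ one_ne_zero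
    unfold MerEq
    filter_upwards [hfe, hunit.ne] with u hu hu0
    rw [one_mul] at hu0
    rw [hu, hz, thetaProd_cons, one_mul, hθ _ (eexp_ne_zero Ω u), neg_neg]
    field_simp

/-! ### Quotients of elliptic gamma functions -/

/-- The quotient `∏ⱼ Γ(tⱼ e^{2πiu/Ω}; p, q) / Γ(wⱼ e^{2πiu/Ω}; p, q)`. -/
noncomputable def gammaProd {ι : Type*} [Fintype ι] (Ω p q : ℂ) (t w : ι → ℂ) (u : ℂ) : ℂ :=
  ∏ j, ellipticGamma (t j * eexp Ω u) p q / ellipticGamma (w j * eexp Ω u) p q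

theorem merUnit_ellipticGamma_eexp {p q Ω t : ℂ} (hp : ‖p‖ < 1) (hq : ‖q‖ < 1) (hp0 : p ≠ 0)
    (hq0 : q ≠ 0) (hΩ : Ω ≠ 0) (ht : t ≠ 0) :
    MerUnit (fun u => ellipticGamma (t * eexp Ω u) p q) := by
  have e : ∀ u, ellipticGamma (t * eexp Ω u) p q =
      doublePoch (p * q * t⁻¹ * eexp (-Ω) u) p q / doublePoch (t * eexp Ω u) p q := fun u => by
    rw [ellipticGamma_eq, eexp_neg_left, mul_inv, mul_assoc (p * q)]
  simp only [e]
  have hs := summable_norm_pow_mul_pow hp hq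
  exact (merUnit_linProd_eexp hs (neg_ne_zero.2 hΩ)
    (mul_ne_zero (mul_ne_zero hp0 hq0) (inv_ne_zero ht))).div (merUnit_linProd_eexp hs hΩ ht)

section gammaProd

variable {ι : Type*} [Fintype ι] {Ω p q : ℂ} {t w : ι → ℂ}

theorem merUnit_gammaProd (hp : ‖p‖ < 1) (hq : ‖q‖ < 1) (hp0 : p ≠ 0) (hq0 : q ≠ 0) (hΩ : Ω ≠ 0)
    (ht : ∀ j, t j ≠ 0) (hw : ∀ j, w j ≠ 0) : MerUnit (gammaProd Ω p q t w) :=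
  MerUnit.prod _ fun j _ => (merUnit_ellipticGamma_eexp hp hq hp0 hq0 hΩ (ht j)).div
    (merUnit_ellipticGamma_eexp hp hq hp0 hq0 hΩ (hw j))

theorem gammaProd_comm (Ω p q : ℂ) (t w : ι → ℂ) : gammaProd Ω p q t w = gammaProd Ω q p t w := by
  funext u
  simp only [gammaProd, ellipticGamma_comm _ p q]

theorem gammaProd_add_self (hΩ : Ω ≠ 0) (u : ℂ) :
    gammaProd Ω p q t w (u + Ω) = gammaProd Ω p q t w u := by
  simp only [gammaProd, eexp_add, eexp_self hΩ, mul_one]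

theorem eventually_mulTheta_ne_zero (hq : ‖q‖ < 1) (hq0 : q ≠ 0) (hΩ : Ω ≠ 0)
    (ht : ∀ j, t j ≠ 0) : ∀ᶠ u in codiscrete ℂ, ∀ j, mulTheta (t j * eexp Ω u) q ≠ 0 :=
  eventually_all.2 fun j => (merUnit_mulTheta_eexp hq hq0 hΩ (ht j)).ne

theorem eventually_ellipticGamma_ne_zero (hp : ‖p‖ < 1) (hq : ‖q‖ < 1) (hp0 : p ≠ 0)
    (hq0 : q ≠ 0) (hΩ : Ω ≠ 0) (ht : ∀ j, t j ≠ 0) :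
    ∀ᶠ u in codiscrete ℂ, ∀ j, ellipticGamma (t j * eexp Ω u) p q ≠ 0 :=
  eventually_all.2 fun j => (merUnit_ellipticGamma_eexp hp hq hp0 hq0 hΩ (ht j)).ne

theorem gammaProd_add_left {A : ℂ} (hA : eexp Ω A = p) (hp : ‖p‖ < 1) (hq : ‖q‖ < 1)
    (hq0 : q ≠ 0) (hΩ : Ω ≠ 0) (ht : ∀ j, t j ≠ 0) (hw : ∀ j, w j ≠ 0) :
    MerEq (fun u => gammaProd Ω p q t w (u + A))
      (fun u => thetaProd Ω q t w u * gammaProd Ω p q t w u) := by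
  have hp0 : p ≠ 0 := hA ▸ eexp_ne_zero _ _
  unfold MerEq
  filter_upwards [eventually_mulTheta_ne_zero hq hq0 hΩ ht,
    eventually_mulTheta_ne_zero hq hq0 hΩ hw] with u h1 h2
  simp only [gammaProd, thetaProd]
  rw [← Finset.prod_mul_distrib]
  refine Finset.prod_congr rfl fun j _ => ?_
  have e : ∀ x : ℂ, x * eexp Ω (u + A) = p * (x * eexp Ω u) := fun x => by
    rw [eexp_add, hA]; ring
  rw [e, e, ellipticGamma_mul hp hq hp0 (h1 j), ellipticGamma_mul hp hq hp0 (h2 j),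
    mul_div_mul_comm]

theorem gammaProd_add_right {B : ℂ} (hB : eexp Ω B = q) (hp : ‖p‖ < 1) (hq : ‖q‖ < 1)
    (hp0 : p ≠ 0) (hΩ : Ω ≠ 0) (ht : ∀ j, t j ≠ 0) (hw : ∀ j, w j ≠ 0) :
    MerEq (fun u => gammaProd Ω p q t w (u + B))
      (fun u => thetaProd Ω p t w u * gammaProd Ω p q t w u) := by
  rw [gammaProd_comm]
  exact gammaProd_add_left hB hq hp hp0 hΩ ht hw

/-- Every quotient of theta functions is a balanced quotient of elliptic gamma functions. -/
theorem thetaProd_merEq_gammaProd (hp : ‖p‖ < 1) (hq : ‖q‖ < 1) (hp0 : p ≠ 0)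
    (hq0 : q ≠ 0) (hΩ : Ω ≠ 0) (ht : ∀ j, t j ≠ 0) (hw : ∀ j, w j ≠ 0) :
    MerEq (thetaProd Ω q t w) (gammaProd Ω p q (Sum.elim (fun j => p * t j) w)
      (Sum.elim t (fun j => p * w j))) := by
  unfold MerEq
  filter_upwards [eventually_mulTheta_ne_zero hq hq0 hΩ ht,
    eventually_mulTheta_ne_zero hq hq0 hΩ hw,
    eventually_ellipticGamma_ne_zero hp hq hp0 hq0 hΩ ht,
    eventually_ellipticGamma_ne_zero hp hq hp0 hq0 hΩ hw] with u h1 h2 h3 h4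
  simp only [gammaProd, thetaProd, Fintype.prod_sum_type, Sum.elim_inl, Sum.elim_inr]
  rw [← Finset.prod_mul_distrib]
  refine Finset.prod_congr rfl fun j _ => ?_
  -- Each theta value is Γ(pz)/Γ(z).
  rw [mul_assoc p, mul_assoc p, ellipticGamma_mul hp hq hp0 (h1 j),
    ellipticGamma_mul hp hq hp0 (h2 j)]
  rw [mul_div_cancel_right₀ _ (h3 j), div_mul_cancel_right₀ (h4 j), div_eq_mul_inv]

end gammaProd

/-! ### Multipliers and their ellipticity -/

/-- The multiplier `f(u + a) / f(u)`. -/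
noncomputable def ratio (a : ℂ) (f : ℂ → ℂ) (u : ℂ) : ℂ := f (u + a) / f u

theorem ratio_merEq {a : ℂ} {f g : ℂ → ℂ} (hf : MerUnit f)
    (h : MerEq (fun u => f (u + a)) (fun u => g u * f u)) : MerEq (ratio a f) g := by
  unfold MerEq
  filter_upwards [h, hf.ne] with u hu hu0
  exact (div_eq_iff hu0).2 hu

theorem merEq_ratio_mul {a : ℂ} {f : ℂ → ℂ} (hf : MerUnit f) :
    MerEq (fun u => f (u + a)) (fun u => ratio a f u * f u) := by
  unfold MerEq
  filter_upwards [hf.ne] with u hu0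
  exact (div_mul_cancel₀ _ hu0).symm

theorem ratio_mul (a : ℂ) (f g : ℂ → ℂ) :
    ratio a (fun u => f u * g u) = fun u => ratio a f u * ratio a g u := by
  funext u
  exact mul_div_mul_comm _ _ _ _

theorem MerEq.period_neg {f : ℂ → ℂ} {a : ℂ} (h : MerEq (fun u => f (u + a)) f) :
    MerEq (fun u => f (u + -a)) f :=
  MerEq.span_period (s := {a}) (by simpa using h)
    (neg_mem (Submodule.subset_span (Set.mem_singleton a)))

namespace IsElliptic

variable {a b : ℂ} {f g : ℂ → ℂ}

theorem symm (h : IsElliptic a b f) : IsElliptic b a f := ⟨h.1, h.2.2, h.2.1⟩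

theorem neg_left (h : IsElliptic a b f) : IsElliptic (-a) b f := ⟨h.1, h.2.1.period_neg, h.2.2⟩

theorem mul (hf : IsElliptic a b f) (hg : IsElliptic a b g) :
    IsElliptic a b (fun u => f u * g u) :=
  ⟨hf.1.fun_mul hg.1, hf.2.1.mul hg.2.1, hf.2.2.mul hg.2.2⟩

theorem inv_shift (hf : IsElliptic a b f) (c : ℂ) : IsElliptic a b (fun u => (f (u + c))⁻¹) := by
  have h : ∀ {d : ℂ}, MerEq (fun u => f (u + d)) f →
      MerEq (fun u => (f (u + d + c))⁻¹) (fun u => (f (u + c))⁻¹) := by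
    intro d hd
    have := (hd.shift c).inv
    simp only [add_right_comm _ c d] at this
    exact this
  exact ⟨(hf.1.comp_add_const c).fun_inv, h hf.2.1, h hf.2.2⟩

theorem congr (hf : IsElliptic a b f) (h : MerEq f g) : IsElliptic a b g :=
  ⟨hf.1.congr_codiscrete h, (h.shift a).symm.trans (hf.2.1.trans h),
    (h.shift b).symm.trans (hf.2.2.trans h)⟩

theorem const (a b c : ℂ) : IsElliptic a b (fun _ => c) :=
  ⟨.const c, EventuallyEq.rfl, EventuallyEq.rfl⟩

/-- The multiplier along `c` is the inverse of the multiplier along `-c`, translated by `c`. It is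
needed because the second gamma family lives on the periods -ω₁, -ω₃, ω₂. -/
theorem ratio_of_neg {c : ℂ} (h : IsElliptic a b (ratio (-c) f)) : IsElliptic a b (ratio c f) := by
  have e : ratio c f = fun u => (ratio (-c) f (u + c))⁻¹ := by
    funext u
    simp only [ratio, add_neg_cancel_right, inv_div]
  rw [e]
  exact h.inv_shift c

end IsElliptic

theorem isElliptic_thetaProd {ι : Type*} [Fintype ι] {Ω q σ : ℂ} {t w : ι → ℂ} (hq : ‖q‖ < 1)
    (hσ : eexp Ω σ = q) (hΩ : Ω ≠ 0) (ht : ∀ j, t j ≠ 0) (hw : ∀ j, w j ≠ 0)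
    (hbal : ∏ j, t j = ∏ j, w j) : IsElliptic Ω σ (thetaProd Ω q t w) := by
  have hq0 : q ≠ 0 := hσ ▸ eexp_ne_zero _ _
  refine ⟨(merUnit_thetaProd hq hq0 hΩ ht hw).mer,
    Eventually.of_forall fun u => thetaProd_add_self hΩ u, Eventually.of_forall fun u => ?_⟩
  have h0 : ∏ j, w j ≠ 0 := Finset.prod_ne_zero_iff.2 fun j _ => hw j
  change thetaProd Ω q t w (u + σ) = _
  rw [thetaProd_add hq hσ ht hw, hbal, div_self h0, one_mul]

/-- All three multipliers of a nonzero meromorphic function are elliptic. -/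
def EllipticRatios (ω₁ ω₂ ω₃ : ℂ) (f : ℂ → ℂ) : Prop :=
  EllipticCoefficients ω₁ ω₂ ω₃ (ratio ω₁ f) (ratio ω₂ f) (ratio ω₃ f)

theorem EllipticRatios.mul {ω₁ ω₂ ω₃ : ℂ} {f g : ℂ → ℂ} (hf : EllipticRatios ω₁ ω₂ ω₃ f)
    (hg : EllipticRatios ω₁ ω₂ ω₃ g) : EllipticRatios ω₁ ω₂ ω₃ (fun u => f u * g u) := by
  unfold EllipticRatios EllipticCoefficients
  simp only [ratio_mul]
  exact ⟨hf.1.mul hg.1, hf.2.1.mul hg.2.1, hf.2.2.mul hg.2.2⟩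

theorem ellipticRatios_exp (ω₁ ω₂ ω₃ γ : ℂ) :
    EllipticRatios ω₁ ω₂ ω₃ (fun u => Complex.exp (γ * u)) := by
  have e : ∀ a, ratio a (fun u => Complex.exp (γ * u)) = fun _ => Complex.exp (γ * a) := by
    intro a
    funext u
    rw [ratio, mul_add, Complex.exp_add, mul_div_cancel_left₀ _ (Complex.exp_ne_zero _)]
  unfold EllipticRatios EllipticCoefficients
  simp only [e]
  exact ⟨.const _ _ _, .const _ _ _, .const _ _ _⟩

theorem isElliptic_ratio_gammaProd {ι : Type*} [Fintype ι] {Ω A B : ℂ} {t w : ι → ℂ}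
    (hA : ‖eexp Ω A‖ < 1) (hB : ‖eexp Ω B‖ < 1) (hΩ : Ω ≠ 0) (ht : ∀ j, t j ≠ 0)
    (hw : ∀ j, w j ≠ 0) (hbal : ∏ j, t j = ∏ j, w j) :
    IsElliptic Ω B (ratio A (gammaProd Ω (eexp Ω A) (eexp Ω B) t w)) ∧
    IsElliptic Ω A (ratio B (gammaProd Ω (eexp Ω A) (eexp Ω B) t w)) ∧
    ∀ b c, IsElliptic b c (ratio Ω (gammaProd Ω (eexp Ω A) (eexp Ω B) t w)) := by
  have hA0 := eexp_ne_zero Ω A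
  have hB0 := eexp_ne_zero Ω B
  have hu := merUnit_gammaProd hA hB hA0 hB0 hΩ ht hw
  refine ⟨(isElliptic_thetaProd hB rfl hΩ ht hw hbal).congr
      (ratio_merEq hu (gammaProd_add_left rfl hA hB hB0 hΩ ht hw)).symm,
    (isElliptic_thetaProd hA rfl hΩ ht hw hbal).congr
      (ratio_merEq hu (gammaProd_add_right rfl hA hB hA0 hΩ ht hw)).symm, fun b c => ?_⟩
  refine (IsElliptic.const b c 1).congr (ratio_merEq (g := fun _ => 1) hu ?_).symm
  exact Eventually.of_forall fun u => (gammaProd_add_self hΩ u).trans (one_mul _).symm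

/-! ### The Meijer product and its parameters -/

theorem meijerProduct_eq (ω₁ ω₂ p q r qt : ℂ) (P : MeijerParams) (u : ℂ) :
    meijerProduct ω₁ ω₂ p q r qt P u = gammaProd ω₂ p q P.t P.w u *
      gammaProd (-ω₁) r qt P.t' P.w' u * Complex.exp (P.γ * u) := by
  have e : Complex.exp (-2 * Real.pi * Complex.I * u / ω₁) = eexp (-ω₁) u := by
    rw [eexp]; congr 1; ring
  rw [meijerProduct, e]
  rfl

theorem exists_fin_reindex {ι : Type*} [Fintype ι] [Nonempty ι] :
    ∃ m : ℕ, Nonempty (Fin (m + 1) ≃ ι) := by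
  obtain ⟨m, hm⟩ := Nat.exists_eq_succ_of_ne_zero (Fintype.card_ne_zero (α := ι))
  exact ⟨m, ⟨(Fintype.equivFinOfCardEq hm).symm⟩⟩

/-- Arbitrary finite index types allow parameter families to be concatenated as sum types. -/
theorem exists_meijerParams {ι ι' : Type*} [Fintype ι] [Nonempty ι] [Fintype ι'] [Nonempty ι']
    {t w : ι → ℂ} {t' w' : ι' → ℂ} (ht : ∀ j, t j ≠ 0) (hw : ∀ j, w j ≠ 0)
    (ht' : ∀ j, t' j ≠ 0) (hw' : ∀ j, w' j ≠ 0) (hb : ∏ j, t j = ∏ j, w j)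
    (hb' : ∏ j, t' j = ∏ j, w' j) (γ : ℂ) :
    ∃ P : MeijerParams, ∀ ω₁ ω₂ p q r qt u : ℂ, meijerProduct ω₁ ω₂ p q r qt P u =
      gammaProd ω₂ p q t w u * gammaProd (-ω₁) r qt t' w' u * Complex.exp (γ * u) := by
  obtain ⟨m, ⟨e⟩⟩ := exists_fin_reindex (ι := ι)
  obtain ⟨m', ⟨e'⟩⟩ := exists_fin_reindex (ι := ι')
  refine ⟨⟨m, m', t ∘ e, w ∘ e, t' ∘ e', w' ∘ e', γ, fun j => ht _, fun j => hw _, fun j => ht' _,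
    fun j => hw' _, ?_, ?_⟩, fun ω₁ ω₂ p q r qt u => ?_⟩
  · simpa only [Function.comp_apply, e.prod_comp] using hb
  · simpa only [Function.comp_apply, e'.prod_comp] using hb'
  · rw [meijerProduct_eq]
    congr 2
    · exact e.prod_comp fun j => ellipticGamma (t j * eexp ω₂ u) p q /
        ellipticGamma (w j * eexp ω₂ u) p q
    · exact e'.prod_comp fun j => ellipticGamma (t' j * eexp (-ω₁) u) r qt /
        ellipticGamma (w' j * eexp (-ω₁) u) r qt

/-! ### Classification of the solutions -/

/-- The periods `ω₂`, `ω₁`, `ω₃` follow each other counterclockwise within a half-plane. -/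
structure OrderedPeriods (ω₁ ω₂ ω₃ : ℂ) : Prop where
  im₃₂ : 0 < (ω₃ / ω₂).im
  im₁₂ : 0 < (ω₁ / ω₂).im
  im₃₁ : 0 < (ω₃ / ω₁).im

namespace OrderedPeriods

variable {ω₁ ω₂ ω₃ : ℂ}

theorem ne₁ (h : OrderedPeriods ω₁ ω₂ ω₃) : ω₁ ≠ 0 := by
  rintro rfl; simpa using h.im₁₂

theorem ne₂ (h : OrderedPeriods ω₁ ω₂ ω₃) : ω₂ ≠ 0 := by
  rintro rfl; simpa using h.im₁₂

theorem norm_p (h : OrderedPeriods ω₁ ω₂ ω₃) : ‖eexp ω₂ ω₃‖ < 1 :=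
  (norm_eexp_lt_one_iff _ _).2 h.im₃₂

theorem norm_q (h : OrderedPeriods ω₁ ω₂ ω₃) : ‖eexp ω₂ ω₁‖ < 1 :=
  (norm_eexp_lt_one_iff _ _).2 h.im₁₂

theorem im_neg (h : OrderedPeriods ω₁ ω₂ ω₃) : 0 < (-ω₃ / -ω₁).im := by
  rw [neg_div_neg_eq]; exact h.im₃₁

theorem norm_r (h : OrderedPeriods ω₁ ω₂ ω₃) : ‖eexp (-ω₁) (-ω₃)‖ < 1 :=
  (norm_eexp_lt_one_iff _ _).2 h.im_neg

theorem norm_qt (h : OrderedPeriods ω₁ ω₂ ω₃) : ‖eexp (-ω₁) ω₂‖ < 1 := by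
  rw [norm_eexp_lt_one_iff, div_neg, Complex.neg_im, ← inv_div, Complex.inv_im, neg_div, neg_neg]
  refine div_pos h.im₁₂ (Complex.normSq_pos.2 (div_ne_zero h.ne₁ h.ne₂))

end OrderedPeriods

section

variable {ω₁ ω₂ ω₃ : ℂ}

/-- The product with `p`, `q`, `r`, `q̃` expressed through the periods. -/
noncomputable abbrev meijerOfPeriods (ω₁ ω₂ ω₃ : ℂ) (P : MeijerParams) : ℂ → ℂ :=
  meijerProduct ω₁ ω₂ (eexp ω₂ ω₃) (eexp ω₂ ω₁) (eexp (-ω₁) (-ω₃)) (eexp (-ω₁) ω₂) P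

theorem merUnit_meijer (h : OrderedPeriods ω₁ ω₂ ω₃) (P : MeijerParams) :
    MerUnit (meijerOfPeriods ω₁ ω₂ ω₃ P) := by
  rw [meijerOfPeriods, funext (meijerProduct_eq _ _ _ _ _ _ P)]
  exact ((merUnit_gammaProd h.norm_p h.norm_q (eexp_ne_zero _ _) (eexp_ne_zero _ _) h.ne₂
    P.t_ne_zero P.w_ne_zero).mul (merUnit_gammaProd h.norm_r h.norm_qt (eexp_ne_zero _ _)
    (eexp_ne_zero _ _) (neg_ne_zero.2 h.ne₁) P.t'_ne_zero P.w'_ne_zero)).mul (MerUnit.exp _)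

theorem ellipticRatios_meijer (h : OrderedPeriods ω₁ ω₂ ω₃) (P : MeijerParams) :
    EllipticRatios ω₁ ω₂ ω₃ (meijerOfPeriods ω₁ ω₂ ω₃ P) := by
  rw [meijerOfPeriods, funext (meijerProduct_eq _ _ _ _ _ _ P)]
  refine EllipticRatios.mul (EllipticRatios.mul ?_ ?_) (ellipticRatios_exp _ _ _ _)
  · obtain ⟨hA, hB, hΩ⟩ := isElliptic_ratio_gammaProd h.norm_p h.norm_q h.ne₂
      P.t_ne_zero P.w_ne_zero P.balanced
    exact ⟨hB, hΩ _ _, hA.symm⟩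
  · obtain ⟨hA, hB, hΩ⟩ := isElliptic_ratio_gammaProd h.norm_r h.norm_qt (neg_ne_zero.2 h.ne₁)
      P.t'_ne_zero P.w'_ne_zero P.balanced'
    refine ⟨(hΩ _ _).ratio_of_neg, ?_, ?_⟩
    · simpa using hB.neg_left.symm.neg_left.symm
    · simpa using hA.ratio_of_neg.neg_left

theorem isMeromorphicSolution_const_mul {h₁ h₂ h₃ Φ Δ : ℂ → ℂ}
    (hΦ : IsMeromorphicSolution ω₁ ω₂ ω₃ h₁ h₂ h₃ Φ) {c : ℂ} (hΔ : MerEq Δ (fun u => c * Φ u)) :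
    IsMeromorphicSolution ω₁ ω₂ ω₃ h₁ h₂ h₃ Δ := by
  have key : ∀ {a : ℂ} {g : ℂ → ℂ}, MerEq (fun u => Φ (u + a)) (fun u => g u * Φ u) →
      MerEq (fun u => Δ (u + a)) (fun u => g u * Δ u) := by
    intro a g h
    have hs := hΔ.shift a
    unfold MerEq
    filter_upwards [h, hΔ, hs] with u h1 h2 h3
    rw [h3, h1, h2]; ring
  exact ⟨(Meromorphic.fun_mul (.const c) hΦ.1).congr_codiscrete hΔ.symm, key hΦ.2.1, key hΦ.2.2.1,
    key hΦ.2.2.2⟩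

/-- Every nonzero solution of a system with elliptic coefficients is a constant times
a product of elliptic gamma functions and an exponential. -/
theorem exists_merEq_meijer (h : OrderedPeriods ω₁ ω₂ ω₃) {h₁ h₂ h₃ Δ : ℂ → ℂ}
    (hh : EllipticCoefficients ω₁ ω₂ ω₃ h₁ h₂ h₃)
    (hΔ : IsMeromorphicSolution ω₁ ω₂ ω₃ h₁ h₂ h₃ Δ) (hΔ0 : MerUnit Δ) :
    ∃ (P : MeijerParams) (c : ℂ), c ≠ 0 ∧
      MerEq Δ (fun u => c * meijerOfPeriods ω₁ ω₂ ω₃ P u) := by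
  have hω₁ : -ω₁ ≠ 0 := neg_ne_zero.2 h.ne₁
  have hu₁ : MerUnit h₁ := ((hΔ0.shift ω₁).div hΔ0).congr (ratio_merEq hΔ0 hΔ.2.1)
  have hu₂ : MerUnit h₂ := ((hΔ0.shift ω₂).div hΔ0).congr (ratio_merEq hΔ0 hΔ.2.2.1)
  obtain ⟨n, t, w, c₁, ht, hw, hc₁, hbal, he₁⟩ :=
    exists_balanced_thetaProd h.im₃₂ hu₁ hh.1.2.1 hh.1.2.2
  obtain ⟨n', t', w', c₂, ht', hw', hc₂, hbal', he₂⟩ :=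
    exists_balanced_thetaProd h.im_neg hu₂ hh.2.1.2.1.period_neg hh.2.1.2.2.period_neg
  set p := eexp ω₂ ω₃ with hp
  set q := eexp ω₂ ω₁ with hq
  set r := eexp (-ω₁) (-ω₃) with hr
  set qt := eexp (-ω₁) ω₂ with hqt
  have hp0 : p ≠ 0 := eexp_ne_zero _ _
  have hq0 : q ≠ 0 := eexp_ne_zero _ _
  have hr0 : r ≠ 0 := eexp_ne_zero _ _
  have hqt0 : qt ≠ 0 := eexp_ne_zero _ _
  set G₁ := gammaProd ω₂ p q t w with hG₁
  set G₂ := gammaProd (-ω₁) r qt t' w' with hG₂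
  have hG₁u : MerUnit G₁ := merUnit_gammaProd h.norm_p h.norm_q hp0 hq0 h.ne₂ ht hw
  have hG₂u : MerUnit G₂ := merUnit_gammaProd h.norm_r h.norm_qt hr0 hqt0 hω₁ ht' hw'
  have hG₁ω₁ : MerEq (fun u => G₁ (u + ω₁)) (fun u => thetaProd ω₂ p t w u * G₁ u) :=
    gammaProd_add_right hq.symm h.norm_p h.norm_q hp0 h.ne₂ ht hw
  have hG₂ω₂ : MerEq (fun u => G₂ (u + ω₂)) (fun u => thetaProd (-ω₁) r t' w' u * G₂ u) :=
    gammaProd_add_right hqt.symm h.norm_r h.norm_qt hr0 hω₁ ht' hw'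
  have hG₁ω₂ : ∀ u, G₁ (u + ω₂) = G₁ u := gammaProd_add_self h.ne₂
  have hG₂ω₁ : ∀ u, G₂ (u + ω₁) = G₂ u := fun u => by
    have := gammaProd_add_self (p := r) (q := qt) (t := t') (w := w') hω₁ (u + ω₁)
    rw [add_neg_cancel_right] at this
    exact this.symm
  -- `G₁` and `G₂` carry the non-constant parts of `h₁` and `h₂` without disturbing each other's
  -- equation, so only `c₁` and `c₂` remain.
  set g : ℂ → ℂ := fun u => Δ u / (G₁ u * G₂ u) with hg
  have hgu : MerUnit g := hΔ0.div (hG₁u.mul hG₂u)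
  have hgω₁ : MerEq (fun u => g (u + ω₁)) (fun u => c₁ * g u) := by
    unfold MerEq
    filter_upwards [hΔ.2.1, he₁, hG₁ω₁, (hG₁u.shift ω₁).ne] with u h1 h2 h3 h4
    simp only [hg]
    rw [h3] at h4
    rw [h1, h2, h3, hG₂ω₁]
    have h5 := left_ne_zero_of_mul h4
    field_simp
  have hgω₂ : MerEq (fun u => g (u + ω₂)) (fun u => c₂ * g u) := by
    unfold MerEq
    filter_upwards [hΔ.2.2.1, he₂, hG₂ω₂, (hG₂u.shift ω₂).ne] with u h1 h2 h3 h4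
    simp only [hg]
    rw [h3] at h4
    rw [h1, h2, h3, hG₁ω₂]
    have h5 := left_ne_zero_of_mul h4
    field_simp
  obtain ⟨k, a, b, C, β, ha, hb, hC, hge⟩ :=
    exists_theta_quotient_of_multipliers h.im₁₂ hgu hgω₂ hgω₁
  change MerEq g (fun u => C * Complex.exp (β * u) * thetaProd ω₂ q a b u) at hge
  have hab := thetaProd_merEq_gammaProd h.norm_p h.norm_q hp0 hq0 h.ne₂ ha hb
  -- The theta quotient of nome `q` joins the first gamma family. It contributes the factor `p` once
  -- for each `a j` above and once for each `b j` below, so balance is preserved.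
  obtain ⟨P, hP⟩ := exists_meijerParams (t := Sum.elim t (Sum.elim (fun j => p * a j) b))
    (w := Sum.elim w (Sum.elim a (fun j => p * b j))) (t' := t') (w' := w')
    (by rintro (j | j | j); exacts [ht j, mul_ne_zero hp0 (ha j), hb j])
    (by rintro (j | j | j); exacts [hw j, ha j, mul_ne_zero hp0 (hb j)]) ht' hw'
    (by
      simp only [Fintype.prod_sum_type, Sum.elim_inl, Sum.elim_inr, Finset.prod_mul_distrib, hbal]
      ring) hbal' β
  refine ⟨P, C, hC, ?_⟩
  unfold MerEq
  filter_upwards [hge, hab, hG₁u.ne, hG₂u.ne] with u h1 h2 h3 h4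
  have e : gammaProd ω₂ p q (Sum.elim t (Sum.elim (fun j => p * a j) b))
      (Sum.elim w (Sum.elim a (fun j => p * b j))) u = G₁ u * thetaProd ω₂ q a b u := by
    rw [h2, gammaProd, Fintype.prod_sum_type]
    rfl
  rw [meijerOfPeriods, hP, e]
  have h5 : Δ u = g u * (G₁ u * G₂ u) := (div_mul_cancel₀ _ (mul_ne_zero h3 h4)).symm
  rw [h5, h1]
  ring

end

/-! ### The theorem -/

theorem mainTheorem2 (ω₁ ω₂ ω₃ p q r qt : ℂ)
    (hp_def : p = Complex.exp (2 * Real.pi * Complex.I * ω₃ / ω₂))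
    (hq_def : q = Complex.exp (2 * Real.pi * Complex.I * ω₁ / ω₂))
    (hr_def : r = Complex.exp (2 * Real.pi * Complex.I * ω₃ / ω₁))
    (hqt_def : qt = Complex.exp (-2 * Real.pi * Complex.I * ω₂ / ω₁))
    (hp : ‖p‖ < 1) (hq : ‖q‖ < 1) (hr : ‖r‖ < 1) :
    -- the functions that solve some system with elliptic coefficients are exactly the products
    (∀ Δ : ℂ → ℂ,
      (∃ h₁ h₂ h₃ : ℂ → ℂ, EllipticCoefficients ω₁ ω₂ ω₃ h₁ h₂ h₃ ∧
          IsMeromorphicSolution ω₁ ω₂ ω₃ h₁ h₂ h₃ Δ) ↔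
        ∃ (P : MeijerParams) (c : ℂ),
          MerEq Δ (fun u => c * meijerProduct ω₁ ω₂ p q r qt P u)) ∧
    -- for incommensurate periods and a given system with a nonzero solution,
    -- the general solution is a constant times one such product
    (LinearIndependent ℤ ![ω₁, ω₂, ω₃] →
      ∀ h₁ h₂ h₃ : ℂ → ℂ, EllipticCoefficients ω₁ ω₂ ω₃ h₁ h₂ h₃ →
        (∃ Δ₀ : ℂ → ℂ, IsMeromorphicSolution ω₁ ω₂ ω₃ h₁ h₂ h₃ Δ₀ ∧
          ¬ MerEq Δ₀ (fun _ => 0)) →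
        ∃ P : MeijerParams, ∀ Δ : ℂ → ℂ,
          IsMeromorphicSolution ω₁ ω₂ ω₃ h₁ h₂ h₃ Δ ↔
            ∃ c : ℂ, MerEq Δ (fun u => c * meijerProduct ω₁ ω₂ p q r qt P u)) := by
  have ep : p = eexp ω₂ ω₃ := hp_def
  have eq : q = eexp ω₂ ω₁ := hq_def
  have er' : r = eexp ω₁ ω₃ := hr_def
  have er : r = eexp (-ω₁) (-ω₃) := by rw [er', eexp_neg_left, eexp_neg, inv_inv]
  have eqt : qt = eexp (-ω₁) ω₂ := by
    rw [hqt_def, eexp]; congr 1; ring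
  have h : OrderedPeriods ω₁ ω₂ ω₃ := by
    rw [ep, norm_eexp_lt_one_iff] at hp
    rw [eq, norm_eexp_lt_one_iff] at hq
    rw [er', norm_eexp_lt_one_iff] at hr
    exact ⟨hp, hq, hr⟩
  have hM : ∀ P, meijerProduct ω₁ ω₂ p q r qt P = meijerOfPeriods ω₁ ω₂ ω₃ P := fun P => by
    rw [ep, eq, er, eqt]
  simp only [hM]
  refine ⟨fun Δ => ⟨?_, ?_⟩, ?_⟩
  · rintro ⟨h₁, h₂, h₃, hh, hΔ⟩
    by_cases h0 : MerEq Δ (fun _ => 0)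
    -- The zero solution is any product with constant 0.
    · obtain ⟨P, -⟩ := exists_meijerParams (ι := Unit) (ι' := Unit) (t := fun _ => 1)
        (w := fun _ => 1) (t' := fun _ => 1) (w' := fun _ => 1) (fun _ => one_ne_zero)
        (fun _ => one_ne_zero) (fun _ => one_ne_zero) (fun _ => one_ne_zero) rfl rfl 0
      exact ⟨P, 0, by simpa only [zero_mul] using h0⟩
    · obtain ⟨P, c, -, hc⟩ := exists_merEq_meijer h hh hΔ (hΔ.1.merUnit h0)
      exact ⟨P, c, hc⟩
  · rintro ⟨P, c, hΔ⟩
    have hΦ := merUnit_meijer h P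
    -- The coefficients are the multipliers of the product, not of `Δ`, so that `c = 0` is covered.
    exact ⟨_, _, _, ellipticRatios_meijer h P, isMeromorphicSolution_const_mul
      ⟨hΦ.mer, merEq_ratio_mul hΦ, merEq_ratio_mul hΦ, merEq_ratio_mul hΦ⟩ hΔ⟩
  · rintro hlin h₁ h₂ h₃ hh ⟨Δ₀, hΔ₀, hne⟩
    obtain ⟨P, c, hc, hP⟩ := exists_merEq_meijer h hh hΔ₀ (hΔ₀.1.merUnit hne)
    have hΦ := merUnit_meijer h P
    have hsol : IsMeromorphicSolution ω₁ ω₂ ω₃ h₁ h₂ h₃ (meijerOfPeriods ω₁ ω₂ ω₃ P) := by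
      refine isMeromorphicSolution_const_mul hΔ₀ (c := c⁻¹) ?_
      unfold MerEq
      filter_upwards [hP] with u hu
      rw [hu, inv_mul_cancel_left₀ hc]
    refine ⟨P, fun Δ => ⟨fun hΔ => ?_, fun ⟨c', hc'⟩ => isMeromorphicSolution_const_mul hsol hc'⟩⟩
    -- Where the product does not vanish after the shift, `g u` is nonzero too and cancels, so the
    -- quotient of two solutions has period `a`.
    have hper : ∀ {a : ℂ} {g : ℂ → ℂ}, MerEq (fun u => Δ (u + a)) (fun u => g u * Δ u) →
        MerEq (fun u => meijerOfPeriods ω₁ ω₂ ω₃ P (u + a))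
          (fun u => g u * meijerOfPeriods ω₁ ω₂ ω₃ P u) →
        MerEq (fun u => Δ (u + a) / meijerOfPeriods ω₁ ω₂ ω₃ P (u + a))
          (fun u => Δ u / meijerOfPeriods ω₁ ω₂ ω₃ P u) := by
      intro a g hg1 hg2
      unfold MerEq
      filter_upwards [hg1, hg2, (hΦ.shift a).ne] with u h1 h2 h3
      rw [h2] at h3
      rw [h1, h2, mul_div_mul_left _ _ (left_ne_zero_of_mul h3)]
    obtain ⟨c', hc'⟩ := merEq_const_of_three_periods (hΔ.1.fun_div hΦ.mer) hlin (by
      intro i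
      fin_cases i
      · exact hper hΔ.2.1 hsol.2.1
      · exact hper hΔ.2.2.1 hsol.2.2.1
      · exact hper hΔ.2.2.2 hsol.2.2.2)
    refine ⟨c', ?_⟩
    unfold MerEq
    filter_upwards [hc', hΦ.ne] with u h1 h2
    exact (div_eq_iff h2).1 h1
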